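/- **Setting.** Let $n\ge 1$, $d\ge 2$, let $\Omega\subset\mathbb R^d$ be open (bounded or not), $Q=[0,1]^d$, $\lambda,\nu>0$. A subscript $\#$ denotes $\mathbb Z^d$-periodicity. Let $a^{(1)},a^{(0)}\in (L^\infty_\#(Q))^{n\times d\times n\times d}$ be symmetric ($a^{(l)}_{ijpq}=a^{(l)}_{pqij}$) and $\rho\in L^\infty_\#(Q)$ with $\rho\ge\nu$, such that $a^{(1)}(y)\zeta\cdot\zeta\ge 0$ for all $\zeta\in\mathbb R^{n\times d}$, and, for some constant tensor $A^{(0)}$, $(a^{(0)}(y)+a^{(1)}(y))\zeta\cdot\zeta\ge A^{(0)}\zeta\cdot\zeta$ for all $\zeta\in\mathbb R^{n\times d}$ and $A^{(0)}_{ijpq}\xi_i\eta_j\xi_p\eta_q\ge\nu|\xi|^2|\eta|^2$ for all $\xi\in\mathbb R^n$, $\eta\in\mathbb R^d$. Here $(a\zeta)_{ij}=a_{ijpq}\zeta_{pq}$, $(\nabla u)_{ij}=\partial u_i/\partial x_j$, $(\mathrm{div}\,B)_i=\partial B_{ij}/\partial x_j$ (summation over repeated indices), and $(a^{(1)})^{1/2}$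 is the non-negative symmetric square root of $a^{(1)}$. Put $$V=\{v\in (H^1_\#(Q))^n:\ a^{(1)}\nabla_y v=0\},\qquad W=\{\psi\in (L^2_\#(Q))^{n\times d}:\ \mathrm{div}_y\big((a^{(1)})^{1/2}\psi\big)=0\ \text{in}\ (H^{-1}_\#(Q))^n\}.$$ **Key assumption.** There is $C>0$ such that for every $v\in (H^1_\#(Q))^n$ there is $v_1\in V$ with $\|v-v_1\|_{(H^1_\#(Q))^n}\le C\,\|a^{(1)}\nabla_y v\|_{L^2(Q)}$. Let $\varepsilon\to0^+$ along a sequence, let $f^\varepsilon$ be bounded in $(L^2(\Omega))^n$ uniformly in $\varepsilon$, and let $u^\varepsilon\in (H^1_0(\Omega))^n$ be the weak solution of $$-\mathrm{div}\big(a^\varepsilon\nabla u^\varepsilon\big)+\lambda\,\rho(x/\varepsilon)\,u^\varepsilon=f^\varepsilon\ \text{ in }\Omega,\qquad a^\varepsilon(x)=a^{(1)}(x/\varepsilon)+\varepsilon^2a^{(0)}(x/\varepsilon).$$ Let $u_0\in L^2(\Omega;V)$ and $\xi_0\in L^2(\Omega;W)$ be such that, along this sequence, in the sense of weak two-scale convergence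 (tested against $D(\Omega;C^\infty_\#(Q))$), $$u^\varepsilon\stackrel{2}{\rightharpoonup}u_0(x,y),\qquad \varepsilon\nabla u^\varepsilon\stackrel{2}{\rightharpoonup}\nabla_yu_0(x,y),\qquad (a^{(1)}(x/\varepsilon))^{1/2}\nabla u^\varepsilon\stackrel{2}{\rightharpoonup}\xi_0(x,y).$$ **Statement.** Under the key assumption, $$\int_\Omega\int_Q\xi_0(x,y)\cdot\Psi(x,y)\,dy\,dx=-\int_\Omega\int_Q u_0(x,y)\cdot\mathrm{div}_x\big((a^{(1)}(y))^{1/2}\Psi(x,y)\big)\,dy\,dx$$ for every $\Psi\in C^\infty(\overline\Omega;W)$, that is, for every $\Psi$ which is the restriction to $\Omega$ of a $C^\infty$ function $\mathbb R^d\to (L^2(Q))^{n\times d}$ and satisfies $\Psi(x,\cdot)\in W$ for all $x\in\Omega$, such that $\Psi$ and $\mathrm{div}_x\big((a^{(1)})^{1/2}\Psi\big)$ are square integrable over $\Omega\times Q$ (this last condition is automatic if $\Omega$ is bounded). In particular $\Psi$ need not vanish near $\partial\Omega$. -/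

import Mathlib

open MeasureTheory Filter Topology
open scoped ContDiff

namespace TwoScale

/-- Euclidean space `ℝ^d`, the space of the variables `x` and `y`. -/
abbrev Sp (d : ℕ) : Type := EuclideanSpace ℝ (Fin d)

/-- Vectors of `ℝ^n`. -/
abbrev Vec (n : ℕ) : Type := EuclideanSpace ℝ (Fin n)

/-- Real `n × d` matrices `ζ = (ζ_{ij})`, with `ζ · η = ∑ ζ_{ij} η_{ij}` and the corresponding norm. -/
abbrev Mat (n d : ℕ) : Type := EuclideanSpace ℝ (Fin n × Fin d)

/-- Tensors `a_{ijpq}`, with the entry `a_{ijpq}` written `a (i, j) (p, q)`. -/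
abbrev Tens (n d : ℕ) : Type := Matrix (Fin n × Fin d) (Fin n × Fin d) ℝ

/-- The coordinate vector `e_j` of `ℝ^d`. -/
noncomputable def basisVec (d : ℕ) (j : Fin d) : Sp d := EuclideanSpace.single j 1

/-- The action `(a ζ)_{ij} = ∑_{p,q} a_{ijpq} ζ_{pq}`. -/
noncomputable def act {n d : ℕ} (a : Tens n d) (ζ : Mat n d) : Mat n d :=
  WithLp.toLp 2 (Matrix.mulVec a ζ.ofLp)

section SquareRoot

open scoped MatrixOrder Matrix.Norms.L2Operator

/-- The non-negative symmetric square root `a^{1/2}` of a non-negative symmetric tensor. -/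
noncomputable def tensSqrt {n d : ℕ} (a : Tens n d) : Tens n d := CFC.sqrt a

end SquareRoot

/-! ### Periodic functions on the unit cell -/

/-- The periodicity cell `Q = [0,1]^d`. -/
def cell (d : ℕ) : Set (Sp d) := {y | ∀ i, y i ∈ Set.Icc (0 : ℝ) 1}

/-- Lebesgue measure on `Q`. -/
noncomputable abbrev cellMeas (d : ℕ) : Measure (Sp d) := volume.restrict (cell d)

/-- `1`-periodicity in every coordinate. -/
def IsPer {d : ℕ} {F : Type*} (g : Sp d → F) : Prop :=
  ∀ (j : Fin d) (y : Sp d), g (y + basisVec d j) = g y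

/-- `g ∈ L^∞_#(Q)`, as a periodic function on `ℝ^d`. -/
def IsPerLinfty {d : ℕ} (g : Sp d → ℝ) : Prop :=
  IsPer g ∧ AEMeasurable g volume ∧ ∃ C : ℝ, ∀ᵐ y ∂volume, |g y| ≤ C

/-- `L²(Ω; F)`. -/
abbrev L2 {d : ℕ} (F : Type) [NormedAddCommGroup F] (μ : Measure (Sp d)) : Type :=
  Lp F 2 μ

/-- Pairs (function, matrix field) of square integrable functions with the norm
`(‖u‖² + ‖g‖²)^{1/2}`; the Sobolev spaces below consist of the pairs `(u, ∇u)`. -/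
abbrev Pairs {d : ℕ} (n : ℕ) (μ : Measure (Sp d)) : Type :=
  WithLp 2 (L2 (Vec n) μ × L2 (Mat n d) μ)

/-- `g` is the weak gradient on the periodicity torus of `v`: `g_{ij} = ∂ v_i / ∂ y_j`. -/
def IsWeakGradPer {n d : ℕ} (v : L2 (Vec n) (cellMeas d)) (g : L2 (Mat n d) (cellMeas d)) : Prop :=
  ∀ φ : Sp d → ℝ, ContDiff ℝ ∞ φ → IsPer φ → ∀ (i : Fin n) (j : Fin d),
    ∫ y in cell d, v y i * fderiv ℝ φ y (basisVec d j) = - ∫ y in cell d, g y (i, j) * φ y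

/-- `(H^1_#(Q))^n`, an element being identified with the pair `(v, ∇_y v)`. -/
def H1per (n d : ℕ) : Set (Pairs n (cellMeas d)) := {v | IsWeakGradPer v.fst v.snd}

/-- `V = {v ∈ (H^1_#(Q))^n : a ∇_y v = 0}`. -/
def spaceV {n d : ℕ} (a : Sp d → Tens n d) : Set (Pairs n (cellMeas d)) :=
  {v | v ∈ H1per n d ∧ ∀ᵐ y ∂(cellMeas d), act (a y) (v.snd y) = 0}

/-- `W = {ψ ∈ (L²_#(Q))^{n × d} : div_y (a^{1/2} ψ) = 0 in (H^{-1}_#(Q))^n}`, the divergence being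
the functional `w ↦ - ∫_Q a^{1/2} ψ · ∇_y w` on `(H^1_#(Q))^n`. -/
def spaceW {n d : ℕ} (a : Sp d → Tens n d) : Set (L2 (Mat n d) (cellMeas d)) :=
  {ψ | ∀ w ∈ H1per n d,
    ∫ y in cell d, inner ℝ (act (tensSqrt (a y)) (ψ y)) (w.snd y) = 0}

/-- The key assumption: there is `C > 0` such that every `v ∈ (H^1_#(Q))^n` admits `v₁ ∈ V` with
`‖v - v₁‖_{H^1} ≤ C ‖a ∇_y v‖_{L²(Q)}`. -/
def KeyAssumption {n d : ℕ} (a : Sp d → Tens n d) : Prop :=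
  ∃ C : ℝ, 0 < C ∧ ∀ v ∈ H1per n d, ∃ v₁ ∈ spaceV a,
    ENNReal.ofReal ‖v - v₁‖ ≤
      ENNReal.ofReal C * eLpNorm (fun y => act (a y) (v.snd y)) 2 (cellMeas d)

/-! ### The boundary value problem -/

/-- The assumptions on the coefficients `a^{(1)}`, `a^{(0)}`, `ρ`. -/
structure IsAdmissible {n d : ℕ} (ν : ℝ) (a₁ a₀ : Sp d → Tens n d) (ρ : Sp d → ℝ) : Prop where
  bdd₁ : ∀ I J, IsPerLinfty fun y => a₁ y I J
  bdd₀ : ∀ I J, IsPerLinfty fun y => a₀ y I J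
  symm₁ : ∀ᵐ y ∂volume, ∀ I J, a₁ y I J = a₁ y J I
  symm₀ : ∀ᵐ y ∂volume, ∀ I J, a₀ y I J = a₀ y J I
  nonneg₁ : ∀ᵐ y ∂volume, ∀ ζ : Mat n d, 0 ≤ inner ℝ (act (a₁ y) ζ) ζ
  coercive : ∃ A : Tens n d,
    (∀ᵐ y ∂volume, ∀ ζ : Mat n d, inner ℝ (act A ζ) ζ ≤ inner ℝ (act (a₀ y + a₁ y) ζ) ζ) ∧
    ∀ (ξ : Vec n) (η : Sp d), ν * ‖ξ‖ ^ 2 * ‖η‖ ^ 2 ≤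
      ∑ i, ∑ j, ∑ p, ∑ q, A (i, j) (p, q) * ξ i * η j * ξ p * η q
  bddρ : IsPerLinfty ρ
  posρ : ∀ᵐ y ∂volume, ν ≤ ρ y

/-- The classical gradient `(∇φ)_{ij} = ∂ φ_i / ∂ x_j`. -/
noncomputable def grad {n d : ℕ} (φ : Sp d → Vec n) (x : Sp d) : Mat n d :=
  WithLp.toLp 2 fun ij => fderiv ℝ φ x (basisVec d ij.2) ij.1

/-- `(H^1_0(Ω))^n`: the closure in the `H^1`-norm of the smooth functions with compact support
in `Ω`, an element being identified with the pair `(u, ∇u)`. -/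
def H10 (n : ℕ) {d : ℕ} (Ω : Set (Sp d)) : Set (Pairs n ((volume : Measure (Sp d)).restrict Ω)) :=
  closure {u | ∃ φ : Sp d → Vec n, ContDiff ℝ ∞ φ ∧ HasCompactSupport φ ∧ tsupport φ ⊆ Ω ∧
    (u.fst =ᵐ[(volume : Measure (Sp d)).restrict Ω] φ) ∧
    (u.snd =ᵐ[(volume : Measure (Sp d)).restrict Ω] grad φ)}

/-- The tensor `a^ε(x) = a^{(1)}(x/ε) + ε² a^{(0)}(x/ε)`. -/
noncomputable def tensEps {n d : ℕ} (a₁ a₀ : Sp d → Tens n d) (ε : ℝ) (x : Sp d) : Tens n d :=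
  a₁ (ε⁻¹ • x) + ε ^ 2 • a₀ (ε⁻¹ • x)

/-- `u ∈ (H^1_0(Ω))^n` is the weak solution of
`- div (a^ε ∇u) + λ ρ^ε u = f` in `Ω`, where `ρ^ε(x) = ρ(x/ε)`. -/
def IsWeakSolution {n d : ℕ} (Ω : Set (Sp d)) (a₁ a₀ : Sp d → Tens n d) (ρ : Sp d → ℝ)
    (lam ε : ℝ) (f : L2 (Vec n) ((volume : Measure (Sp d)).restrict Ω))
    (u : Pairs n ((volume : Measure (Sp d)).restrict Ω)) : Prop :=
  u ∈ H10 n Ω ∧ ∀ φ ∈ H10 n Ω,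
    ∫ x in Ω, (inner ℝ (act (tensEps a₁ a₀ ε x) (u.snd x)) (φ.snd x)
      + lam * ρ (ε⁻¹ • x) * inner ℝ (u.fst x) (φ.fst x))
    = ∫ x in Ω, inner ℝ (f x) (φ.fst x)

/-! ### Two-scale convergence -/

/-- Test functions `φ(x,y) ∈ D(Ω; C^∞_#(Q))` with values in `F`. -/
def IsTwoScaleTest {d : ℕ} {F : Type} [NormedAddCommGroup F] [NormedSpace ℝ F]
    (Ω : Set (Sp d)) (φ : Sp d × Sp d → F) : Prop :=
  ContDiff ℝ ∞ φ ∧ (∀ x, IsPer fun y => φ (x, y)) ∧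
    ∃ K : Set (Sp d), IsCompact K ∧ K ⊆ Ω ∧ ∀ x ∉ K, ∀ y, φ (x, y) = 0

/-- Weak two-scale convergence, along the sequence `ε k → 0`, of the functions `v k` on `Ω` to
`v₀(x,y)`, the latter being regarded as the function `x ↦ v₀(x,·)` with values in `L²(Q)`. -/
def TwoScaleTendsto {d : ℕ} {F : Type} [NormedAddCommGroup F] [InnerProductSpace ℝ F]
    (Ω : Set (Sp d)) (ε : ℕ → ℝ) (v : ℕ → Sp d → F) (v₀ : Sp d → L2 F (cellMeas d)) : Prop :=
  ∀ φ : Sp d × Sp d → F, IsTwoScaleTest Ω φ →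
    Tendsto (fun k => ∫ x in Ω, inner ℝ (v k x) (φ (x, (ε k)⁻¹ • x))) atTop
      (𝓝 (∫ x in Ω, ∫ y in cell d, inner ℝ (v₀ x y) (φ (x, y))))

/-! ### The divergence in the slow variable -/

open Classical in
/-- The product `b ψ ∈ (L²(Q))^{n × d}` of a tensor field `b` and `ψ ∈ (L²(Q))^{n × d}`
(it is square integrable whenever `b` is measurable and bounded). -/
noncomputable def mulL2 {n d : ℕ} (b : Sp d → Tens n d) (ψ : L2 (Mat n d) (cellMeas d)) :
    L2 (Mat n d) (cellMeas d) :=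
  if h : MemLp (fun y => act (b y) (ψ y)) 2 (cellMeas d) then h.toLp _ else 0

/-- The `j`-th column of a matrix, as a continuous linear map. -/
noncomputable def column (n : ℕ) {d : ℕ} (j : Fin d) : Mat n d →L[ℝ] Vec n :=
  LinearMap.toContinuousLinearMap
    { toFun := fun ζ => WithLp.toLp 2 fun i => ζ (i, j)
      map_add' := fun _ _ => rfl
      map_smul' := fun _ _ => rfl }

/-- `(div_x B)_i = ∑_j ∂ B_{ij} / ∂ x_j` for a function `x ↦ B(x,·)` with values in
`(L²(Q))^{n × d}`; the partial derivatives are those of this `L²(Q)`-valued function. -/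
noncomputable def divX {n d : ℕ} (B : Sp d → L2 (Mat n d) (cellMeas d)) (x : Sp d) :
    L2 (Vec n) (cellMeas d) :=
  ∑ j, (column n j).compLp (fderiv ℝ B x (basisVec d j))

/-- The test fields `Ψ ∈ C^∞(Ω; W)`, smooth up to the boundary: restrictions to `Ω` of smooth
functions on `ℝ^d`, with `Ψ(x,·) ∈ W` for `x ∈ Ω`; both `Ψ` and `div_x (a^{1/2} Ψ)` are
square integrable over `Ω × Q` (which is automatic when `Ω` is bounded). -/
structure IsTestField {n d : ℕ} (Ω : Set (Sp d)) (a : Sp d → Tens n d)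
    (Ψ : Sp d → L2 (Mat n d) (cellMeas d)) : Prop where
  smooth : ContDiff ℝ ∞ Ψ
  mem : ∀ x ∈ Ω, Ψ x ∈ spaceW a
  memLp : MemLp Ψ 2 (volume.restrict Ω)
  memLp_div : MemLp (divX fun x => mulL2 (fun y => tensSqrt (a y)) (Ψ x)) 2 (volume.restrict Ω)

end TwoScale

/-! The formula is the two-scale limit of an integration by parts that produces no boundary term
because `u^ε` lies in `H^1_0`, and no term of order `1/ε` because the fast field is divergence-free.
Take a product `φ(x) b(y)` with `b ∈ W` and `φ` smooth with compact support in `ℝ^d`, not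
necessarily in `Ω`. The field `B = (a^{(1)})^{1/2} b` is divergence-free on the torus, so `B(x/ε)`
is divergence-free on `ℝ^d` and `∫ ∇u^ε · φ B(x/ε) = - ∑_j ∫ u^ε · ∂_jφ (B e_j)(x/ε)`. By symmetry
of the root the left side is `∫ (a^{(1)})^{1/2}∇u^ε · φ b(x/ε)`. Both sides converge, and the limits
give the claim for products (`hasProductIdentity`). The identity for smooth `u` extends to `H^1_0`
by closure (`IsDivFree.integral_by_parts`).

Two points need work. The two-scale limits are assumed only for smooth test functions vanishing near
`∂Ω`, whereas here `φ` need not vanish there and `b` is merely in `L²`. Density removes both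
restrictions (`TwoScaleTendsto.tendsto_of_periodic`, `TwoScaleTendsto.tendsto_oscillating`), given
two uniform bounds. One is for `b ↦ φ b(·/ε)` in `L²` (`setLIntegral_ball_frac_smul_le`). The other
is for `u^ε` and `(a^{(1)})^{1/2}∇u^ε` (`energy_estimate`), where the constant tensor is
non-negative only on rank-one matrices, so that its contribution is controlled by Plancherel
(`integral_inner_act_grad_nonneg`).

The passage from products to general `Ψ` is pure Hilbert space analysis: project `Ψ` onto
finite-dimensional subspaces exhausting `W`, which gives finite sums of products, then remove the
compact support by cutoffs (`HasProductIdentity.integral_eq`). -/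

namespace TwoScale

/-! ### The integer lattice and periodic functions -/

/-- The standard basis of `ℝ^d`. -/
noncomputable def stdBasis (d : ℕ) : Module.Basis (Fin d) ℝ (Sp d) :=
  (EuclideanSpace.basisFun (Fin d) ℝ).toBasis

/-- The lattice `ℤ^d`. -/
noncomputable abbrev lattice (d : ℕ) : Submodule ℤ (Sp d) :=
  Submodule.span ℤ (Set.range (stdBasis d))

/-- The half-open unit cell `[0,1)^d`. -/
noncomputable abbrev openCell (d : ℕ) : Set (Sp d) := ZSpan.fundamentalDomain (stdBasis d)

/-- The coordinatewise fractional part. -/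
noncomputable def frac {d : ℕ} (y : Sp d) : Sp d := ZSpan.fract (stdBasis d) y

theorem stdBasis_repr {d : ℕ} (y : Sp d) (i : Fin d) : (stdBasis d).repr y i = y i := by
  simp [stdBasis]

theorem stdBasis_apply {d : ℕ} (j : Fin d) : stdBasis d j = basisVec d j := by
  simp [stdBasis, basisVec]

theorem frac_apply {d : ℕ} (y : Sp d) (i : Fin d) : frac y i = Int.fract (y i) := by
  rw [← stdBasis_repr, frac, ZSpan.repr_fract_apply, stdBasis_repr]

theorem measurable_frac {d : ℕ} : Measurable (frac : Sp d → Sp d) := by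
  have : Measurable fun y : Sp d => (frac y).ofLp := by
    refine measurable_pi_lambda _ fun i => ?_
    simp only [frac_apply]
    fun_prop
  exact (WithLp.measurable_toLp 2 _).comp this

theorem frac_vadd {d : ℕ} (l : lattice d) (y : Sp d) : frac (l +ᵥ y) = frac y :=
  ZSpan.fract_zSpan_add _ _ l.2

theorem frac_mem_openCell {d : ℕ} (y : Sp d) : frac y ∈ openCell d :=
  ZSpan.fract_mem_fundamentalDomain _ _

theorem frac_eq_self {d : ℕ} {y : Sp d} (hy : y ∈ openCell d) : frac y = y :=
  ZSpan.fract_eq_self.2 hy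

theorem mem_openCell {d : ℕ} {y : Sp d} : y ∈ openCell d ↔ ∀ i, y i ∈ Set.Ico (0 : ℝ) 1 := by
  simp only [ZSpan.mem_fundamentalDomain, stdBasis_repr]

theorem measurableSet_openCell (d : ℕ) : MeasurableSet (openCell d) :=
  ZSpan.fundamentalDomain_measurableSet _

theorem openCell_subset_cell (d : ℕ) : openCell d ⊆ cell d :=
  fun _ hy i => Set.Ico_subset_Icc_self (mem_openCell.1 hy i)

theorem isFundamentalDomain_openCell (d : ℕ) :
    IsAddFundamentalDomain (lattice d) (openCell d) (volume : Measure (Sp d)) :=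
  ZSpan.isAddFundamentalDomain _ _

/-- Links the closed cell of the statement to the half-open one, which is an exact fundamental
domain of the lattice. -/
theorem openCell_ae_eq_cell (d : ℕ) : openCell d =ᵐ[(volume : Measure (Sp d))] cell d := by
  have h : (Set.univ.pi fun _ : Fin d => Set.Ico (0 : ℝ) 1) =ᵐ[volume] Set.Icc 0 1 :=
    Measure.univ_pi_Ico_ae_eq_Icc (f := 0) (g := 1)
  have h' := (PiLp.volume_preserving_ofLp (Fin d)).quasiMeasurePreserving.preimage_ae_eq h
  have e₁ : openCell d = WithLp.ofLp ⁻¹' (Set.univ.pi fun _ : Fin d => Set.Ico (0 : ℝ) 1) := by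
    ext y; simp only [mem_openCell, Set.mem_preimage, Set.mem_univ_pi]
  have e₂ : cell d = WithLp.ofLp ⁻¹' (Set.Icc 0 1) := by
    ext y; simp [cell, Set.mem_Icc, Pi.le_def, forall_and]
  rw [e₁, e₂]
  exact h'

theorem cellMeas_eq (d : ℕ) : cellMeas d = volume.restrict (openCell d) :=
  (Measure.restrict_congr_set (openCell_ae_eq_cell d)).symm

theorem volume_cell (d : ℕ) : volume (cell d) = 1 := by
  have h := (PiLp.volume_preserving_ofLp (Fin d)).measure_preimage
    (s := Set.Icc 0 1) measurableSet_Icc.nullMeasurableSet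
  rw [Real.volume_Icc_pi] at h
  simp only [Pi.one_apply, Pi.zero_apply, sub_zero, ENNReal.ofReal_one, Finset.prod_const_one] at h
  rw [← h]
  congr 1
  ext y
  simp [cell, Set.mem_Icc, Pi.le_def, forall_and]

instance (d : ℕ) : IsProbabilityMeasure (cellMeas d) :=
  ⟨by rw [Measure.restrict_apply_univ, volume_cell]⟩

theorem isCompact_cell (d : ℕ) : IsCompact (cell d) := by
  have : cell d = (EuclideanSpace.equiv (Fin d) ℝ).toHomeomorph ⁻¹' Set.Icc 0 1 := by
    ext y
    simp [cell, Set.mem_Icc, Pi.le_def, forall_and, EuclideanSpace.equiv]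
  rw [this]
  exact (Homeomorph.isCompact_preimage _).2 isCompact_Icc

theorem frac_ae_eq_id (d : ℕ) : ∀ᵐ y ∂(cellMeas d), frac y = y := by
  rw [cellMeas_eq]
  exact (ae_restrict_mem (measurableSet_openCell d)).mono fun y hy => frac_eq_self hy

instance (d : ℕ) : VAddInvariantMeasure (lattice d) (Sp d) volume :=
  ⟨fun l s _ => measure_preimage_add volume (l : Sp d) s⟩

theorem IsPer.add_lattice {d : ℕ} {F : Type*} {g : Sp d → F} (hg : IsPer g) {l : Sp d}
    (hl : l ∈ lattice d) : ∀ y, g (y + l) = g y := by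
  induction hl using Submodule.span_induction with
  | mem x hx =>
    obtain ⟨j, rfl⟩ := hx
    intro y
    rw [stdBasis_apply, hg]
  | zero => simp
  | add x y _ _ hx hy => intro z; rw [← add_assoc, hy, hx]
  | smul a x _ hx =>
    induction a using Int.induction_on with
    | zero => simp
    | succ i ih => intro z; rw [add_smul, one_smul, ← add_assoc, hx, ih]
    | pred i ih =>
      intro z
      have := hx (z + (-(i : ℤ) - 1) • x)
      rw [← this, add_assoc, sub_smul, one_smul, sub_add_cancel, ih]

theorem IsPer.comp_frac {d : ℕ} {F : Type*} {g : Sp d → F} (hg : IsPer g) (y : Sp d) :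
    g (frac y) = g y := by
  have := hg.add_lattice (ZSpan.floor (stdBasis d) y).2 (frac y)
  rw [← this, frac, ZSpan.fract_apply, sub_add_cancel]

/-- The preimage of a null set is lattice-invariant and meets the fundamental domain in a null set,
so it is null. This makes `b (frac y)`, the periodic extension of a class `b` in `L²(Q)`, well
defined almost everywhere on `ℝ^d`. -/
theorem quasiMeasurePreserving_frac (d : ℕ) :
    Measure.QuasiMeasurePreserving (frac : Sp d → Sp d) volume (cellMeas d) := by
  refine ⟨measurable_frac, ?_⟩
  refine Measure.AbsolutelyContinuous.mk fun s hs h0 => ?_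
  rw [Measure.map_apply measurable_frac hs]
  refine (isFundamentalDomain_openCell d).measure_zero_of_invariant _ (fun l => ?_) ?_
  · ext y
    rw [Set.mem_vadd_set_iff_neg_vadd_mem, Set.mem_preimage, Set.mem_preimage, frac_vadd]
  · rw [cellMeas_eq, Measure.restrict_apply hs] at h0
    refine measure_mono_null ?_ h0
    rintro y ⟨hy, hc⟩
    exact ⟨by rwa [Set.mem_preimage, frac_eq_self hc] at hy, hc⟩

theorem quasiMeasurePreserving_smul {d : ℕ} {c : ℝ} (hc : c ≠ 0) :
    Measure.QuasiMeasurePreserving (fun x : Sp d => c • x) volume volume := by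
  refine ⟨measurable_const_smul c, ?_⟩
  rw [Measure.map_addHaar_smul _ hc]
  exact Measure.smul_absolutelyContinuous

theorem quasiMeasurePreserving_frac_smul {d : ℕ} {c : ℝ} (hc : c ≠ 0) :
    Measure.QuasiMeasurePreserving (fun x : Sp d => frac (c • x)) volume (cellMeas d) :=
  (quasiMeasurePreserving_frac d).comp (quasiMeasurePreserving_smul hc)

theorem quasiMeasurePreserving_frac_smul_restrict {d : ℕ} {c : ℝ} (hc : c ≠ 0) (Ω : Set (Sp d)) :
    Measure.QuasiMeasurePreserving (fun x : Sp d => frac (c • x)) (volume.restrict Ω)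
      (cellMeas d) :=
  (quasiMeasurePreserving_frac_smul hc).mono_left Measure.absolutelyContinuous_restrict

/-! ### Averages of periodic functions over balls -/

theorem exists_norm_le_openCell (d : ℕ) : ∃ D : ℝ, 0 ≤ D ∧ ∀ y ∈ openCell d, ‖y‖ ≤ D := by
  obtain ⟨D, hD⟩ := (ZSpan.fundamentalDomain_isBounded (stdBasis d)).exists_norm_le
  exact ⟨max D 0, le_max_right _ _, fun y hy => (hD y hy).trans (le_max_left _ _)⟩

theorem lintegral_openCell_add {d : ℕ} (h : Sp d → ENNReal) (w : Sp d) :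
    ∫⁻ z in openCell d, h (frac (w + z)) = ∫⁻ z in openCell d, h (frac z) := by
  have h1 := ((isFundamentalDomain_openCell d).vadd_of_comm w).setLIntegral_eq
    (isFundamentalDomain_openCell d) (fun z => h (frac z)) (fun l y => by rw [frac_vadd])
  rw [← h1]
  exact (measurePreserving_add_left (volume : Measure (Sp d)) w).setLIntegral_comp_emb
    (measurableEmbedding_addLeft w) (fun z => h (frac z)) (openCell d)

/-- Average over shifts instead of counting cells: integrate the left side over `z` in the unit
cell, of measure one, and substitute `x = w + c⁻¹ z`. The new variable `w` stays in the ball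
enlarged by `|c⁻¹| D`. After Tonelli the integral in `z` is, by periodicity, the cell integral of
`h` for every `w`. -/
theorem setLIntegral_ball_frac_smul_le {d : ℕ} {D : ℝ} (hD : ∀ y ∈ openCell d, ‖y‖ ≤ D)
    {h : Sp d → ENNReal} (hh : Measurable h) (r : ℝ) {c : ℝ} (hc : c ≠ 0) :
    ∫⁻ x in Metric.ball 0 r, h (frac (c • x))
      ≤ volume (Metric.ball (0 : Sp d) (r + |c⁻¹| * D)) * ∫⁻ y in cell d, h y := by
  have hcell : ∫⁻ y in cell d, h y = ∫⁻ z in openCell d, h (frac z) := by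
    rw [show ∫⁻ y in cell d, h y = ∫⁻ y in openCell d, h y by rw [← cellMeas_eq]]
    exact setLIntegral_congr_fun (measurableSet_openCell d) fun z hz => by rw [frac_eq_self hz]
  have hm : Measurable fun y : Sp d => h (frac y) := hh.comp measurable_frac
  have hone : volume (openCell d) = 1 := by
    rw [measure_congr (openCell_ae_eq_cell d), volume_cell]
  calc ∫⁻ x in Metric.ball 0 r, h (frac (c • x))
      = ∫⁻ _z in openCell d, ∫⁻ x in Metric.ball 0 r, h (frac (c • x)) := by
        rw [setLIntegral_const, hone, mul_one]
    _ ≤ ∫⁻ z in openCell d, ∫⁻ w, (Metric.ball (0 : Sp d) (r + |c⁻¹| * D)).indicator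
          (fun w => h (frac (c • w + z))) w := by
        refine setLIntegral_mono' (measurableSet_openCell d) fun z hz => ?_
        rw [← lintegral_indicator measurableSet_ball, ← lintegral_add_right_eq_self _ (c⁻¹ • z)]
        refine lintegral_mono fun w => ?_
        by_cases hw : w + c⁻¹ • z ∈ Metric.ball 0 r
        · have hw' : w ∈ Metric.ball 0 (r + |c⁻¹| * D) := by
            rw [mem_ball_zero_iff] at hw ⊢
            calc ‖w‖ = ‖(w + c⁻¹ • z) - c⁻¹ • z‖ := by rw [add_sub_cancel_right]
              _ ≤ ‖w + c⁻¹ • z‖ + ‖c⁻¹ • z‖ := norm_sub_le _ _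
              _ < r + |c⁻¹| * D := by
                refine add_lt_add_of_lt_of_le hw ?_
                rw [norm_smul, Real.norm_eq_abs]
                exact mul_le_mul_of_nonneg_left (hD z hz) (abs_nonneg _)
          rw [Set.indicator_of_mem hw, Set.indicator_of_mem hw', smul_add, smul_inv_smul₀ hc]
        · rw [Set.indicator_of_notMem hw]
          exact zero_le
    _ = ∫⁻ w, (Metric.ball (0 : Sp d) (r + |c⁻¹| * D)).indicator
          (fun _ => ∫⁻ z in openCell d, h (frac z)) w := by
        rw [lintegral_lintegral_swap]
        · refine lintegral_congr fun w => ?_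
          by_cases hw : w ∈ Metric.ball (0 : Sp d) (r + |c⁻¹| * D)
          · simp only [Set.indicator_of_mem hw, lintegral_openCell_add]
          · simp only [Set.indicator_of_notMem hw, lintegral_zero]
        · refine Measurable.aemeasurable ?_
          refine Measurable.indicator (f := fun p : Sp d × Sp d => h (frac (c • p.2 + p.1)))
            (s := {p | p.2 ∈ Metric.ball (0 : Sp d) (r + |c⁻¹| * D)}) ?_ ?_
          · exact hm.comp ((measurable_snd.const_smul c).add measurable_fst)
          · exact measurable_snd measurableSet_ball
    _ = _ := by
        rw [lintegral_indicator measurableSet_ball, setLIntegral_const, hcell, mul_comm]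

/-- Phrased as domination of measures, the estimate transfers integrability and `L²` norms from the
cell to balls at once. -/
theorem map_frac_smul_restrict_ball_le {d : ℕ} {D : ℝ} (hD : ∀ y ∈ openCell d, ‖y‖ ≤ D)
    (r : ℝ) {c : ℝ} (hc : c ≠ 0) :
    (volume.restrict (Metric.ball (0 : Sp d) r)).map (fun x => frac (c • x))
      ≤ volume (Metric.ball (0 : Sp d) (r + |c⁻¹| * D)) • cellMeas d := by
  have hm : Measurable fun x : Sp d => frac (c • x) :=
    measurable_frac.comp (measurable_const_smul c)
  refine Measure.le_iff.2 fun s hs => ?_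
  have := setLIntegral_ball_frac_smul_le hD (measurable_one.indicator hs) r hc
  rw [lintegral_indicator_one hs] at this
  rw [Measure.map_apply hm hs, Measure.smul_apply, smul_eq_mul]
  rwa [← lintegral_indicator_one (hm hs)]

/-! ### Periodization -/

/-- The periodization `y ↦ ∑_{l ∈ ℤ^d} θ(l + y)`. -/
noncomputable def periodize {d : ℕ} {F : Type*} [AddCommMonoid F] (θ : Sp d → F) (y : Sp d) : F :=
  ∑ᶠ l : lattice d, θ (l +ᵥ y)

theorem finite_lattice_of_isBounded {d : ℕ} {s : Set (Sp d)} (hs : Bornology.IsBounded s) :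
    {l : lattice d | (l : Sp d) ∈ s}.Finite := by
  have := ZSpan.setFinite_inter (stdBasis d) hs
  refine Set.Finite.of_finite_image (f := Subtype.val) (this.subset ?_)
    Subtype.val_injective.injOn
  rintro _ ⟨l, hl, rfl⟩
  exact ⟨hl, l.2⟩

/-- Gives both the local finiteness behind the regularity of periodizations and the reduction of the
unfolding series to a finite sum. -/
theorem finite_lattice_translates {d : ℕ} {F : Type*} [Zero F] {θ : Sp d → F}
    (hθ : HasCompactSupport θ) {s : Set (Sp d)} (hs : Bornology.IsBounded s) :
    {l : lattice d | ∃ y ∈ s, θ (l +ᵥ y) ≠ 0}.Finite := by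
  obtain ⟨R, hR⟩ := hθ.isCompact.isBounded.exists_norm_le
  obtain ⟨S, hS⟩ := hs.exists_norm_le
  refine (finite_lattice_of_isBounded (Metric.isBounded_closedBall (x := (0 : Sp d))
    (r := R + S))).subset ?_
  rintro l ⟨y, hy, hne⟩
  have h1 := hR _ (subset_tsupport _ (Function.mem_support.2 hne))
  rw [Set.mem_ofPred_eq, mem_closedBall_zero_iff]
  calc ‖(l : Sp d)‖ = ‖(l +ᵥ y) - y‖ := by
        rw [show l +ᵥ y = (l : Sp d) + y from rfl, add_sub_cancel_right]
    _ ≤ ‖l +ᵥ y‖ + ‖y‖ := norm_sub_le _ _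
    _ ≤ R + S := add_le_add h1 (hS y hy)

theorem locallyFinite_translates {d : ℕ} {F : Type*} [Zero F] {θ : Sp d → F}
    (hθ : HasCompactSupport θ) :
    LocallyFinite fun l : lattice d => Function.support fun y => θ (l +ᵥ y) := fun y =>
  ⟨Metric.ball y 1, Metric.ball_mem_nhds y one_pos,
    (finite_lattice_translates hθ Metric.isBounded_ball).subset
      fun _ ⟨z, hz, hzb⟩ => ⟨z, hzb, hz⟩⟩

theorem isPer_periodize {d : ℕ} {F : Type*} [AddCommMonoid F] (θ : Sp d → F) :
    IsPer (periodize θ) := by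
  intro j y
  have hj : basisVec d j ∈ lattice d := by
    rw [← stdBasis_apply]
    exact Submodule.subset_span ⟨j, rfl⟩
  unfold periodize
  rw [← finsum_comp_equiv (Equiv.addRight (⟨basisVec d j, hj⟩ : lattice d))
    (f := fun l : lattice d => θ (l +ᵥ y))]
  refine finsum_congr fun l => ?_
  congr 1
  change (l : Sp d) + (y + basisVec d j) = ((l : Sp d) + basisVec d j) + y
  abel

theorem ContDiff.periodize {d : ℕ} {F : Type*} [NormedAddCommGroup F] [NormedSpace ℝ F]
    {θ : Sp d → F} {m : WithTop ℕ∞} (hs : ContDiff ℝ m θ) (hθ : HasCompactSupport θ) :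
    ContDiff ℝ m (periodize θ) := by
  rw [← contMDiff_iff_contDiff]
  refine contMDiff_finsum (fun l => ?_) (locallyFinite_translates hθ)
  rw [contMDiff_iff_contDiff]
  exact hs.comp (contDiff_const.add contDiff_id)

theorem Continuous.periodize {d : ℕ} {F : Type*} [NormedAddCommGroup F]
    {θ : Sp d → F} (hs : Continuous θ) (hθ : HasCompactSupport θ) :
    Continuous (periodize θ) :=
  continuous_finsum (fun _ => hs.comp (continuous_const.add continuous_id))
    (locallyFinite_translates hθ)

theorem integrableOn_ball_comp_frac {d : ℕ} {F : Type*} [NormedAddCommGroup F] {g : Sp d → F}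
    (hg : Integrable g (cellMeas d)) (r : ℝ) :
    IntegrableOn (fun y => g (frac y)) (Metric.ball 0 r) := by
  obtain ⟨D, -, hD⟩ := exists_norm_le_openCell d
  have hle := map_frac_smul_restrict_ball_le hD r one_ne_zero
  simp only [one_smul] at hle
  exact (hg.of_measure_le_smul measure_ball_lt_top.ne hle).comp_measurable measurable_frac

theorem locallyIntegrable_comp_frac {d : ℕ} {F : Type*} [NormedAddCommGroup F] {g : Sp d → F}
    (hg : Integrable g (cellMeas d)) : LocallyIntegrable fun y => g (frac y) := by
  intro y
  refine ⟨Metric.ball 0 (‖y‖ + 1), Metric.isOpen_ball.mem_nhds ?_, integrableOn_ball_comp_frac hg _⟩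
  simp

/-- Unfolding: the integral of a periodization against a periodic function. -/
theorem integral_smul_comp_frac {d : ℕ} {F : Type*} [NormedAddCommGroup F] [NormedSpace ℝ F]
    {θ : Sp d → ℝ} (hc : Continuous θ) (hθ : HasCompactSupport θ) {g : Sp d → F}
    (hg : Integrable g (cellMeas d)) :
    ∫ y, θ y • g (frac y) = ∫ y in cell d, periodize θ y • g y := by
  have hint : Integrable fun y => θ y • g (frac y) :=
    (locallyIntegrable_comp_frac hg).integrable_smul_left_of_hasCompactSupport hc hθ
  have hfin := finite_lattice_translates hθ (ZSpan.fundamentalDomain_isBounded (stdBasis d))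
  -- Outside this finite set of translates nothing contributes on the cell, so series and integral
  -- can be exchanged as a finite sum.
  have hS : ∀ l ∉ hfin.toFinset, ∀ y ∈ openCell d, θ (l +ᵥ y) = 0 := by
    intro l hl y hy
    by_contra hne
    exact hl (hfin.mem_toFinset.2 ⟨y, hy, hne⟩)
  rw [(isFundamentalDomain_openCell d).integral_eq_tsum'' _ hint,
    ← setIntegral_congr_set (openCell_ae_eq_cell d)]
  rw [tsum_eq_sum (s := hfin.toFinset), ← integral_finsetSum]
  · refine setIntegral_congr_fun (measurableSet_openCell d) fun y hy => ?_
    simp only [frac_vadd, frac_eq_self hy, periodize]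
    rw [← Finset.sum_smul, finsum_eq_sum_of_support_subset]
    intro l hl
    by_contra hl'
    exact hl (hS l hl' y hy)
  · intro l _
    have := (measurePreserving_vadd l (volume : Measure (Sp d))).integrable_comp_of_integrable hint
    exact this.integrableOn
  · intro l hl
    rw [setIntegral_congr_fun (g := fun _ => 0) (measurableSet_openCell d), integral_zero]
    intro y hy
    simp only [hS l hl y hy, zero_smul]

/-! ### Tensors and their square roots -/

theorem act_apply {n d : ℕ} (a : Tens n d) (ζ : Mat n d) (I : Fin n × Fin d) :
    act a ζ I = ∑ J, a I J * ζ J := rfl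

theorem act_add {n d : ℕ} (a : Tens n d) (ζ η : Mat n d) : act a (ζ + η) = act a ζ + act a η := by
  simp [act, Matrix.mulVec_add]

theorem act_smul {n d : ℕ} (a : Tens n d) (c : ℝ) (ζ : Mat n d) :
    act a (c • ζ) = c • act a ζ := by
  simp [act, Matrix.mulVec_smul]

theorem add_act {n d : ℕ} (a b : Tens n d) (ζ : Mat n d) : act (a + b) ζ = act a ζ + act b ζ := by
  simp [act, Matrix.add_mulVec]

theorem smul_act {n d : ℕ} (c : ℝ) (a : Tens n d) (ζ : Mat n d) :
    act (c • a) ζ = c • act a ζ := by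
  simp [act, Matrix.smul_mulVec]

theorem mul_act {n d : ℕ} (a b : Tens n d) (ζ : Mat n d) : act (a * b) ζ = act a (act b ζ) := by
  simp [act, Matrix.mulVec_mulVec]

theorem inner_act_left {n d : ℕ} (a : Tens n d) (ζ η : Mat n d) :
    inner ℝ (act a ζ) η = ∑ I, ∑ J, a I J * ζ J * η I := by
  simp only [PiLp.inner_apply, act_apply, RCLike.inner_apply, conj_trivial,
    Finset.mul_sum]
  exact Finset.sum_congr rfl fun I _ => Finset.sum_congr rfl fun J _ => by ring

theorem inner_act_comm {n d : ℕ} {a : Tens n d} (ha : ∀ I J, a I J = a J I) (ζ η : Mat n d) :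
    inner ℝ (act a ζ) η = inner ℝ ζ (act a η) := by
  rw [← real_inner_comm, real_inner_comm, inner_act_left, real_inner_comm, inner_act_left,
    Finset.sum_comm]
  exact Finset.sum_congr rfl fun I _ => Finset.sum_congr rfl fun J _ => by rw [ha J I]; ring

theorem norm_act_le {n d : ℕ} (a : Tens n d) (ζ : Mat n d) :
    ‖act a ζ‖ ≤ (∑ I, ∑ J, |a I J|) * ‖ζ‖ := by
  have h : act a ζ = ∑ I, (act a ζ I) • EuclideanSpace.single I (1 : ℝ) := by
    ext K
    simp [Pi.single_apply]
  rw [h, Finset.sum_mul]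
  refine (norm_sum_le _ _).trans (Finset.sum_le_sum fun I _ => ?_)
  rw [norm_smul, PiLp.norm_single, norm_one, mul_one, act_apply, Finset.sum_mul]
  refine (norm_sum_le _ _).trans (Finset.sum_le_sum fun J _ => ?_)
  rw [norm_mul, Real.norm_eq_abs]
  exact mul_le_mul_of_nonneg_left (PiLp.norm_apply_le ζ J) (abs_nonneg _)

section SquareRoot

open scoped MatrixOrder Matrix.Norms.L2Operator

theorem nonneg_of_act {n d : ℕ} {a : Tens n d} (hs : ∀ I J, a I J = a J I)
    (hp : ∀ ζ : Mat n d, 0 ≤ inner ℝ (act a ζ) ζ) : 0 ≤ a := by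
  rw [Matrix.nonneg_iff_posSemidef]
  refine Matrix.PosSemidef.of_dotProduct_mulVec_nonneg ?_ fun x => ?_
  · ext I J
    simp [hs I J]
  · have := hp (WithLp.toLp 2 x)
    rw [inner_act_left] at this
    simpa [dotProduct, Matrix.mulVec, Finset.mul_sum, mul_comm] using this

theorem tensSqrt_symm {n d : ℕ} (a : Tens n d) (I J : Fin n × Fin d) :
    tensSqrt a I J = tensSqrt a J I := by
  have h : (0 : Tens n d) ≤ tensSqrt a := CFC.sqrt_nonneg a
  rw [Matrix.nonneg_iff_posSemidef] at h
  have := congrFun (congrFun h.isHermitian J) I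
  simpa using this

theorem tensSqrt_mul_self {n d : ℕ} {a : Tens n d} (ha : 0 ≤ a) :
    tensSqrt a * tensSqrt a = a :=
  CFC.sqrt_mul_sqrt_self a ha

/-- The square root is continuous on the closed set `S` of symmetric non-negative tensors. Extended
by `0` off `S` it is Borel, and `a y ∈ S` for almost every `y`. -/
theorem aemeasurable_tensSqrt {n d : ℕ} {a : Sp d → Tens n d} {μ : Measure (Sp d)}
    (hm : ∀ I J, AEMeasurable (fun y => a y I J) μ) (hs : ∀ᵐ y ∂μ, ∀ I J, a y I J = a y J I)
    (hp : ∀ᵐ y ∂μ, ∀ ζ : Mat n d, 0 ≤ inner ℝ (act (a y) ζ) ζ) (I J : Fin n × Fin d) :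
    AEMeasurable (fun y => tensSqrt (a y) I J) μ := by
  classical
  let S : Set (Fin n × Fin d → Fin n × Fin d → ℝ) :=
    (⋂ I, ⋂ J, {x | x I J = x J I}) ∩
      ⋂ ζ : Mat n d, {x | 0 ≤ ∑ I, ∑ J, x I J * ζ J * ζ I}
  have hclosed : IsClosed S :=
    (isClosed_iInter fun I => isClosed_iInter fun J => isClosed_eq (by fun_prop) (by fun_prop)).inter
      (isClosed_iInter fun ζ => isClosed_le (by fun_prop) (by fun_prop))
  have hS : ∀ x, x ∈ S ↔
      (∀ I J, x I J = x J I) ∧ ∀ ζ : Mat n d, 0 ≤ inner ℝ (act (Matrix.of x) ζ) ζ := fun x => by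
    simp only [S, Set.mem_inter_iff, Set.mem_iInter, Set.mem_ofPred_eq, inner_act_left,
      Matrix.of_apply]
  have hm' : AEMeasurable (β := Fin n × Fin d → Fin n × Fin d → ℝ) a μ :=
    aemeasurable_pi_lambda _ fun I => aemeasurable_pi_lambda _ fun J => hm I J
  have hcont : ContinuousOn
      (fun x : Fin n × Fin d → Fin n × Fin d → ℝ => tensSqrt (Matrix.of x) I J) S := by
    have h1 : ContinuousOn (fun x : Tens n d => tensSqrt x I J) {x | 0 ≤ x} :=
      (continuous_id.matrix_elem I J).comp_continuousOn CFC.continuousOn_sqrt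
    exact h1.comp (Continuous.continuousOn continuous_id) fun x hx =>
      nonneg_of_act ((hS x).1 hx).1 ((hS x).1 hx).2
  have hmeas := hcont.measurable_piecewise
    (continuousOn_const (c := (0 : ℝ))) hclosed.measurableSet
  refine (hmeas.comp_aemeasurable hm').congr ?_
  filter_upwards [hs, hp] with y h1 h2
  exact Set.piecewise_eq_of_mem S _ _ ((hS (a y)).2 ⟨h1, h2⟩)

end SquareRoot

theorem norm_act_tensSqrt_sq {n d : ℕ} {a : Tens n d} (hs : ∀ I J, a I J = a J I)
    (hp : ∀ ζ : Mat n d, 0 ≤ inner ℝ (act a ζ) ζ) (ζ : Mat n d) :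
    ‖act (tensSqrt a) ζ‖ ^ 2 = inner ℝ (act a ζ) ζ := by
  rw [← real_inner_self_eq_norm_sq, inner_act_comm (tensSqrt_symm a), ← mul_act,
    tensSqrt_mul_self (nonneg_of_act hs hp), real_inner_comm]

/-! ### Bounded measurable tensor fields -/

/-- Measurable, essentially bounded tensor fields. -/
def IsBddTensor {n d : ℕ} (b : Sp d → Tens n d) : Prop :=
  (∀ I J, AEMeasurable (fun y => b y I J) volume) ∧
    ∃ C : ℝ, 0 ≤ C ∧ ∀ᵐ y ∂volume, ∀ ζ : Mat n d, ‖act (b y) ζ‖ ≤ C * ‖ζ‖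

theorem isBddTensor_of_entries {n d : ℕ} {a : Sp d → Tens n d}
    (ha : ∀ I J, IsPerLinfty fun y => a y I J) : IsBddTensor a := by
  refine ⟨fun I J => (ha I J).2.1, ?_⟩
  choose C hC using fun I J => (ha I J).2.2
  refine ⟨∑ I, ∑ J, |C I J|, by positivity, ?_⟩
  have h : ∀ᵐ y ∂(volume : Measure (Sp d)), ∀ I J, |a y I J| ≤ C I J :=
    ae_all_iff.2 fun I => ae_all_iff.2 fun J => hC I J
  filter_upwards [h] with y hy ζ
  refine (norm_act_le _ _).trans (mul_le_mul_of_nonneg_right ?_ (norm_nonneg _))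
  exact Finset.sum_le_sum fun I _ => Finset.sum_le_sum fun J _ => (hy I J).trans (le_abs_self _)

/-- From `|a^{1/2}ζ|² = aζ·ζ ≤ C|ζ|²`, the root is bounded by `√C`. -/
theorem IsBddTensor.tensSqrt {n d : ℕ} {a : Sp d → Tens n d} (ha : IsBddTensor a)
    (hs : ∀ᵐ y ∂volume, ∀ I J, a y I J = a y J I)
    (hp : ∀ᵐ y ∂volume, ∀ ζ : Mat n d, 0 ≤ inner ℝ (act (a y) ζ) ζ) :
    IsBddTensor fun y => tensSqrt (a y) := by
  refine ⟨aemeasurable_tensSqrt ha.1 hs hp, ?_⟩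
  · obtain ⟨C, hC0, hC⟩ := ha.2
    refine ⟨√C, Real.sqrt_nonneg _, ?_⟩
    filter_upwards [hs, hp, hC] with y h1 h2 h3 ζ
    refine abs_le_of_sq_le_sq' ?_ (by positivity) |>.2
    rw [norm_act_tensSqrt_sq h1 h2, mul_pow, Real.sq_sqrt hC0]
    calc inner ℝ (act (a y) ζ) ζ ≤ ‖act (a y) ζ‖ * ‖ζ‖ := real_inner_le_norm _ _
      _ ≤ C * ‖ζ‖ * ‖ζ‖ := mul_le_mul_of_nonneg_right (h3 ζ) (norm_nonneg _)
      _ = C * ‖ζ‖ ^ 2 := by ring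

theorem IsBddTensor.comp_smul {n d : ℕ} {b : Sp d → Tens n d} (hb : IsBddTensor b) {c : ℝ}
    (hc : c ≠ 0) : IsBddTensor fun x => b (c • x) := by
  have hq := quasiMeasurePreserving_smul (d := d) hc
  obtain ⟨hm, C, hC0, hC⟩ := hb
  exact ⟨fun I J => (hm I J).comp_quasiMeasurePreserving hq, C, hC0, hq.ae hC⟩

theorem IsBddTensor.add {n d : ℕ} {a b : Sp d → Tens n d} (ha : IsBddTensor a)
    (hb : IsBddTensor b) : IsBddTensor fun x => a x + b x := by
  obtain ⟨hm, C, hC0, hC⟩ := ha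
  obtain ⟨hm', C', hC0', hC'⟩ := hb
  refine ⟨fun I J => (hm I J).add (hm' I J), C + C', add_nonneg hC0 hC0', ?_⟩
  filter_upwards [hC, hC'] with y h1 h2 ζ
  rw [add_act, add_mul]
  exact (norm_add_le _ _).trans (add_le_add (h1 ζ) (h2 ζ))

theorem IsBddTensor.const_smul {n d : ℕ} {a : Sp d → Tens n d} (ha : IsBddTensor a) (c : ℝ) :
    IsBddTensor fun x => c • a x := by
  obtain ⟨hm, C, hC0, hC⟩ := ha
  refine ⟨fun I J => (hm I J).const_mul c, |c| * C, by positivity, ?_⟩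
  filter_upwards [hC] with y h1 ζ
  rw [smul_act, norm_smul, mul_assoc, Real.norm_eq_abs]
  exact mul_le_mul_of_nonneg_left (h1 ζ) (abs_nonneg _)

theorem isBddTensor_const {n d : ℕ} (A : Tens n d) : IsBddTensor fun _ : Sp d => A :=
  ⟨fun _ _ => aemeasurable_const, ∑ I, ∑ J, |A I J|, by positivity,
    ae_of_all _ fun ζ _ => norm_act_le A _⟩

theorem IsBddTensor.memLp_act {n d : ℕ} {b : Sp d → Tens n d} (hb : IsBddTensor b)
    {μ : Measure (Sp d)} (hμ : μ ≪ volume) {v : Sp d → Mat n d} (hv : MemLp v 2 μ) :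
    MemLp (fun y => act (b y) (v y)) 2 μ := by
  obtain ⟨hm, C, -, hC⟩ := hb
  refine MemLp.of_le_mul (c := C) hv ?_ (Eventually.mono (hμ.ae_le hC) fun y hy => hy _)
  refine AEMeasurable.aestronglyMeasurable ?_
  have : AEMeasurable (fun y => (act (b y) (v y)).ofLp) μ := by
    refine aemeasurable_pi_lambda _ fun I => ?_
    simp only [act_apply]
    refine Finset.aemeasurable_fun_sum _ fun J _ => ((hm I J).mono_ac hμ).mul ?_
    exact (measurable_pi_apply J).comp_aemeasurable
      ((WithLp.measurable_ofLp 2 _).comp_aemeasurable hv.aestronglyMeasurable.aemeasurable)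
  exact (WithLp.measurable_toLp 2 _).comp_aemeasurable this

/-- Multiplication by a bounded tensor field, on square integrable fields. -/
noncomputable def mulTensor {n d : ℕ} {b : Sp d → Tens n d} (hb : IsBddTensor b)
    (μ : Measure (Sp d)) (hμ : μ ≪ volume) : L2 (Mat n d) μ →L[ℝ] L2 (Mat n d) μ :=
  LinearMap.mkContinuousOfExistsBound
    { toFun := fun ψ => (hb.memLp_act hμ (Lp.memLp ψ)).toLp _
      map_add' := fun ψ φ => by
        rw [← MemLp.toLp_add]
        refine MemLp.toLp_congr _ _ ?_
        filter_upwards [Lp.coeFn_add ψ φ] with y hy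
        rw [hy, Pi.add_apply, act_add]
        rfl
      map_smul' := fun c ψ => by
        rw [← MemLp.toLp_const_smul]
        refine MemLp.toLp_congr _ _ ?_
        filter_upwards [Lp.coeFn_smul c ψ] with y hy
        rw [hy, Pi.smul_apply, act_smul]
        rfl }
    (by
      obtain ⟨C, hC0, hC⟩ := hb.2
      refine ⟨C, fun ψ => Lp.norm_le_mul_norm_of_ae_le_mul ?_⟩
      filter_upwards [hμ.ae_le hC, (hb.memLp_act hμ (Lp.memLp ψ)).coeFn_toLp] with y h1 h2
      exact (congrArg _ h2).trans_le (h1 _))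

theorem mulTensor_coeFn {n d : ℕ} {b : Sp d → Tens n d} (hb : IsBddTensor b)
    (μ : Measure (Sp d)) (hμ : μ ≪ volume) (ψ : L2 (Mat n d) μ) :
    mulTensor hb μ hμ ψ =ᵐ[μ] fun y => act (b y) (ψ y) :=
  (hb.memLp_act hμ (Lp.memLp ψ)).coeFn_toLp

theorem cellMeas_ac (d : ℕ) : cellMeas d ≪ volume := Measure.absolutelyContinuous_restrict

theorem mulL2_eq {n d : ℕ} {b : Sp d → Tens n d} (hb : IsBddTensor b)
    (ψ : L2 (Mat n d) (cellMeas d)) : mulL2 b ψ = mulTensor hb _ (cellMeas_ac d) ψ :=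
  dif_pos (hb.memLp_act (cellMeas_ac d) (Lp.memLp ψ))

/-! ### Strongly elliptic constant tensors are non-negative on `H¹₀` -/

theorem _root_.MeasureTheory.MemLp.integrable_inner_of_two {α 𝕜 E : Type*} [MeasurableSpace α]
    {μ : Measure α} [RCLike 𝕜] [NormedAddCommGroup E] [InnerProductSpace 𝕜 E] {f g : α → E}
    (hf : MemLp f 2 μ) (hg : MemLp g 2 μ) : Integrable (fun x => inner 𝕜 (f x) (g x)) μ := by
  refine (hf.norm.integrable_mul hg.norm).mono' ?_ (ae_of_all _ fun x => norm_inner_le_norm _ _)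
  exact hf.aestronglyMeasurable.inner hg.aestronglyMeasurable

theorem grad_apply {n d : ℕ} (φ : Sp d → Vec n) (x : Sp d) (I : Fin n × Fin d) :
    grad φ x I = fderiv ℝ φ x (basisVec d I.2) I.1 := rfl

theorem hasFDerivAt_coord {n d : ℕ} {φ : Sp d → Vec n} {x : Sp d} (hφ : DifferentiableAt ℝ φ x)
    (i : Fin n) : HasFDerivAt (fun z => φ z i)
      ((EuclideanSpace.proj i : Vec n →L[ℝ] ℝ) ∘L fderiv ℝ φ x) x :=
  (EuclideanSpace.proj i : Vec n →L[ℝ] ℝ).hasFDerivAt.comp x hφ.hasFDerivAt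

theorem grad_apply' {n d : ℕ} {φ : Sp d → Vec n} {x : Sp d} (hφ : DifferentiableAt ℝ φ x)
    (I : Fin n × Fin d) :
    grad φ x I = fderiv ℝ (fun z => φ z I.1) x (basisVec d I.2) := by
  rw [grad_apply, (hasFDerivAt_coord hφ I.1).fderiv]
  rfl

theorem continuous_grad {n d : ℕ} {φ : Sp d → Vec n} (hφ : ContDiff ℝ ∞ φ) :
    Continuous (grad φ) := by
  refine (PiLp.continuous_toLp 2 _).comp (continuous_pi fun I => ?_)
  have h1 : Continuous fun x => fderiv ℝ φ x (basisVec d I.2) :=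
    (hφ.continuous_fderiv (by simp)).clm_apply continuous_const
  exact (EuclideanSpace.proj I.1 : Vec n →L[ℝ] ℝ).continuous.comp h1

theorem hasCompactSupport_grad {n d : ℕ} {φ : Sp d → Vec n} (hφ : HasCompactSupport φ) :
    HasCompactSupport (grad φ) := by
  refine (hφ.fderiv ℝ).mono fun x hx => ?_
  rw [Function.mem_support] at hx ⊢
  contrapose! hx
  ext I
  simp [grad_apply, hx]

theorem memLp_grad {n d : ℕ} {φ : Sp d → Vec n} (hφ : ContDiff ℝ ∞ φ)
    (hc : HasCompactSupport φ) (μ : Measure (Sp d)) [IsFiniteMeasureOnCompacts μ] :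
    MemLp (grad φ) 2 μ :=
  (continuous_grad hφ).memLp_of_hasCompactSupport (hasCompactSupport_grad hc)

section Fourier

open scoped FourierTransform SchwartzMap LineDeriv

/-- The integrand may be negative at a point, since `A` is only assumed non-negative on rank-one
matrices. On the Fourier side gradients are rank one: the transform of `∂_jφ_i` is `2πi η_j
φ̂_i(η)`, and Plancherel turns the integral into one of the form `A` evaluated at `φ̂(η) ⊗ η`. -/
theorem integral_inner_act_grad_nonneg {n d : ℕ} {A : Tens n d}
    (hA : ∀ (ξ : Vec n) (η : Sp d),
      0 ≤ ∑ i, ∑ j, ∑ p, ∑ q, A (i, j) (p, q) * ξ i * η j * ξ p * η q)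
    {φ : Sp d → Vec n} (hφ : ContDiff ℝ ∞ φ) (hc : HasCompactSupport φ) :
    0 ≤ ∫ x, inner ℝ (act A (grad φ x)) (grad φ x) := by
  have hF1 : ∀ i : Fin n, ContDiff ℝ ∞ fun x => ((φ x i : ℝ) : ℂ) := fun i =>
    Complex.ofRealCLM.contDiff.comp ((EuclideanSpace.proj i : Vec n →L[ℝ] ℝ).contDiff.comp hφ)
  have hF2 : ∀ i : Fin n, HasCompactSupport fun x => ((φ x i : ℝ) : ℂ) := fun i =>
    hc.comp_left (g := fun v : Vec n => ((v i : ℝ) : ℂ)) (by simp)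
  let F : Fin n → 𝓢(Sp d, ℂ) := fun i => (hF2 i).toSchwartzMap (hF1 i)
  let G : Fin n × Fin d → 𝓢(Sp d, ℂ) := fun I => ∂_{basisVec d I.2} (F I.1)
  have hG : ∀ I x, G I x = ((grad φ x I : ℝ) : ℂ) := by
    intro I x
    have hd : DifferentiableAt ℝ φ x := hφ.differentiable (by simp) x
    have hd' := hasFDerivAt_coord hd I.1
    rw [grad_apply' hd]
    change fderiv ℝ (fun z => ((φ z I.1 : ℝ) : ℂ)) x (basisVec d I.2) = _
    have h2 := (Complex.ofRealCLM.hasFDerivAt (x := φ x I.1)).comp x hd'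
    rw [show (fun z => ((φ z I.1 : ℝ) : ℂ)) = Complex.ofRealCLM ∘ fun z => φ z I.1 from rfl,
      h2.fderiv, hd'.fderiv]
    rfl
  have hFG : ∀ I η, 𝓕 (G I) η = (2 * Real.pi * Complex.I) * (η I.2 : ℂ) * 𝓕 (F I.1) η := by
    intro I η
    have ht : (fun y : Sp d => (inner ℝ y (basisVec d I.2) : ℝ)).HasTemperateGrowth :=
      ((innerSL ℝ).flip (basisVec d I.2)).hasTemperateGrowth
    rw [SchwartzMap.fourier_lineDerivOp_eq]
    simp only [smul_apply, SchwartzMap.smulLeftCLM_apply_apply ht]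
    simp [basisVec, EuclideanSpace.inner_single_right, mul_assoc]
  have hint : ∀ I J, Integrable fun η => inner ℂ (𝓕 (G J) η) (𝓕 (G I) η) := fun I J =>
    ((𝓕 (G J)).memLp 2).integrable_inner_of_two ((𝓕 (G I)).memLp 2)
  have hm := memLp_grad hφ hc volume
  have hmI : ∀ I, MemLp (fun x => grad φ x I) 2 volume := fun I =>
    (EuclideanSpace.proj I : Mat n d →L[ℝ] ℝ).comp_memLp' hm
  have hprod : ∀ I J, ∫ x, grad φ x J * grad φ x I
      = ∫ η, (inner ℂ (𝓕 (G J) η) (𝓕 (G I) η)).re := by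
    intro I J
    have h1 := SchwartzMap.integral_inner_fourier_fourier (G J) (G I)
    have h2 := integral_re (𝕜 := ℂ) (hint I J)
    simp only [RCLike.re_to_complex] at h2
    rw [h2, h1]
    simp only [hG]
    rw [show (fun x => inner ℂ ((grad φ x J : ℝ) : ℂ) ((grad φ x I : ℝ) : ℂ))
      = fun x => ((grad φ x J * grad φ x I : ℝ) : ℂ) by
        funext x; simp [mul_comm], integral_complex_ofReal, Complex.ofReal_re]
  have hsum : ∫ x, inner ℝ (act A (grad φ x)) (grad φ x)
      = ∫ η, ∑ I, ∑ J, A I J * (inner ℂ (𝓕 (G J) η) (𝓕 (G I) η)).re := by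
    simp only [inner_act_left, mul_assoc]
    have i₁ : ∀ I J, Integrable fun x => A I J * (grad φ x J * grad φ x I) := fun I J =>
      ((hmI J).integrable_mul (hmI I)).const_mul _
    have i₂ : ∀ I J, Integrable fun η => A I J * (inner ℂ (𝓕 (G J) η) (𝓕 (G I) η)).re :=
      fun I J => (hint I J).re.const_mul _
    rw [integral_finsetSum _ fun I _ => integrable_finsetSum _ fun J _ => i₁ I J,
      integral_finsetSum _ fun I _ => integrable_finsetSum _ fun J _ => i₂ I J]
    refine Finset.sum_congr rfl fun I _ => ?_
    rw [integral_finsetSum _ fun J _ => i₁ I J, integral_finsetSum _ fun J _ => i₂ I J]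
    refine Finset.sum_congr rfl fun J _ => ?_
    rw [integral_const_mul, hprod]
    exact (integral_const_mul _ _).symm
  rw [hsum]
  refine integral_nonneg fun η => ?_
  -- The mixed products of real and imaginary parts of `φ̂` are purely imaginary and drop out, so
  -- the complex vector `φ̂(η)` splits into two real ones and no symmetry of `A` is needed.
  have hre : ∀ I J, (inner ℂ (𝓕 (G J) η) (𝓕 (G I) η)).re = (2 * Real.pi) ^ 2 * (η J.2 * η I.2 *
      ((𝓕 (F J.1) η).re * (𝓕 (F I.1) η).re + (𝓕 (F J.1) η).im * (𝓕 (F I.1) η).im)) := by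
    intro I J
    rw [hFG, hFG]
    simp
    ring
  let ξ₁ : Vec n := WithLp.toLp 2 fun i => (𝓕 (F i) η).re
  let ξ₂ : Vec n := WithLp.toLp 2 fun i => (𝓕 (F i) η).im
  have key : ∑ I, ∑ J, A I J * (inner ℂ (𝓕 (G J) η) (𝓕 (G I) η)).re
      = (2 * Real.pi) ^ 2 * (∑ i, ∑ j, ∑ p, ∑ q, A (i, j) (p, q) * ξ₁ i * η j * ξ₁ p * η q
        + ∑ i, ∑ j, ∑ p, ∑ q, A (i, j) (p, q) * ξ₂ i * η j * ξ₂ p * η q) := by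
    simp only [hre, Fintype.sum_prod_type, ← Finset.sum_add_distrib, Finset.mul_sum]
    refine Finset.sum_congr rfl fun i _ => Finset.sum_congr rfl fun j _ =>
      Finset.sum_congr rfl fun p _ => Finset.sum_congr rfl fun q _ => ?_
    simp only [ξ₁, ξ₂]
    ring
  rw [key]
  exact mul_nonneg (sq_nonneg _) (add_nonneg (hA ξ₁ η) (hA ξ₂ η))

end Fourier

theorem setIntegral_eq_integral_of_tsupport_subset {X E : Type*} [TopologicalSpace X]
    [MeasurableSpace X] [NormedAddCommGroup E] [NormedSpace ℝ E] {μ : Measure X} {Ω : Set X}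
    {g : X → E} (h : Function.support g ⊆ Ω) : ∫ x in Ω, g x ∂μ = ∫ x, g x ∂μ :=
  setIntegral_eq_integral_of_forall_compl_eq_zero fun _ hx =>
    Function.notMem_support.1 fun h' => hx (h h')

/-- The quadratic form is continuous in the `H^1` norm, so non-negativity passes from smooth
compactly supported functions, extended by zero to `ℝ^d`, to their closure. -/
theorem integral_inner_act_nonneg_of_mem_H10 {n d : ℕ} {A : Tens n d}
    (hA : ∀ (ξ : Vec n) (η : Sp d),
      0 ≤ ∑ i, ∑ j, ∑ p, ∑ q, A (i, j) (p, q) * ξ i * η j * ξ p * η q)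
    {Ω : Set (Sp d)} {u : Pairs n ((volume : Measure (Sp d)).restrict Ω)} (hu : u ∈ H10 n Ω) :
    0 ≤ ∫ x in Ω, inner ℝ (act A (u.snd x)) (u.snd x) := by
  let μ := (volume : Measure (Sp d)).restrict Ω
  have hμ : μ ≪ volume := Measure.absolutelyContinuous_restrict
  let M := mulTensor (isBddTensor_const (d := d) A) μ hμ
  have hM : ∀ v : Pairs n μ, ∫ x in Ω, inner ℝ (act A (v.snd x)) (v.snd x)
      = inner ℝ (M v.snd) v.snd := by
    intro v
    rw [L2.inner_def]
    refine integral_congr_ae ?_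
    filter_upwards [mulTensor_coeFn (isBddTensor_const (d := d) A) μ hμ v.snd] with x hx
    rw [hx]
  have hcl : IsClosed {v : Pairs n μ | 0 ≤ inner ℝ (M v.snd) v.snd} := by
    refine isClosed_le continuous_const ?_
    have hs : Continuous fun v : Pairs n μ => v.snd := (WithLp.prod_continuous_ofLp 2 _ _).snd
    exact (M.continuous.comp hs).inner hs
  rw [hM]
  refine (closure_minimal ?_ hcl) hu
  rintro v ⟨φ, hφ, hc, hsub, -, hv⟩
  rw [Set.mem_ofPred_eq, ← hM, integral_congr_ae (g := fun x => inner ℝ (act A (grad φ x))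
    (grad φ x)) (hv.mono fun x hx => by simp only [hx]),
    setIntegral_eq_integral_of_tsupport_subset]
  · exact integral_inner_act_grad_nonneg hA hφ hc
  · intro x hx
    refine hsub ?_
    by_contra hx'
    refine hx ?_
    have : grad φ x = 0 := by
      ext I
      rw [grad_apply, image_eq_zero_of_notMem_tsupport
        (fun h => hx' (tsupport_fderiv_subset ℝ h))]
      rfl
    simp only [this, inner_zero_right]

/-! ### A priori bounds -/

theorem IsAdmissible.isBddTensor_tensSqrt {n d : ℕ} {ν : ℝ} {a₁ a₀ : Sp d → Tens n d}
    {ρ : Sp d → ℝ} (h : IsAdmissible ν a₁ a₀ ρ) : IsBddTensor fun y => tensSqrt (a₁ y) :=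
  (isBddTensor_of_entries h.bdd₁).tensSqrt h.symm₁ h.nonneg₁

theorem integral_norm_sq_eq {α E : Type*} [MeasurableSpace α] {μ : Measure α}
    [NormedAddCommGroup E] [InnerProductSpace ℝ E] (f : Lp E 2 μ) :
    ∫ x, ‖f x‖ ^ 2 ∂μ = ‖f‖ ^ 2 := by
  rw [← real_inner_self_eq_norm_sq, L2.inner_def]
  simp only [real_inner_self_eq_norm_sq]

/-- Test the equation with `u` itself and regroup `a^ε = (1 - ε²) a^{(1)} + ε² (a^{(0)} + a^{(1)})`.
The first part controls `|(a^{(1)})^{1/2}∇u|²` with factor at least `1/2`, since `ε² ≤ 1/2`. The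
second is bounded below by the constant tensor, whose integral is non-negative on `H^1_0` and is
discarded. -/
theorem energy_estimate {n d : ℕ} {Ω : Set (Sp d)} {ν lam : ℝ} (hν : 0 < ν) (hlam : 0 < lam)
    {a₁ a₀ : Sp d → Tens n d} {ρ : Sp d → ℝ} (hcoeff : IsAdmissible ν a₁ a₀ ρ)
    {ε : ℝ} (hε : 0 < ε) (hε' : ε ^ 2 ≤ 1 / 2)
    {f : L2 (Vec n) ((volume : Measure (Sp d)).restrict Ω)}
    {u : Pairs n ((volume : Measure (Sp d)).restrict Ω)}
    (hu : IsWeakSolution Ω a₁ a₀ ρ lam ε f u) :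
    1 / 2 * ‖mulTensor (hcoeff.isBddTensor_tensSqrt.comp_smul (inv_ne_zero hε.ne')) _
      Measure.absolutelyContinuous_restrict u.snd‖ ^ 2 + lam * ν * ‖u.fst‖ ^ 2
      ≤ ‖f‖ * ‖u.fst‖ := by
  let μ := (volume : Measure (Sp d)).restrict Ω
  have hμ : μ ≪ volume := Measure.absolutelyContinuous_restrict
  have hε1 := inv_ne_zero hε.ne'
  have hq := (quasiMeasurePreserving_smul (d := d) hε1)
  have hb := hcoeff.isBddTensor_tensSqrt.comp_smul hε1
  let v := mulTensor hb μ hμ u.snd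
  have hvae := mulTensor_coeFn hb μ hμ u.snd
  obtain ⟨A, hA1, hA2⟩ := hcoeff.coercive
  obtain ⟨-, hρm, Cρ, hρC⟩ := hcoeff.bddρ
  have hA : ∀ (ξ : Vec n) (η : Sp d),
      0 ≤ ∑ i, ∑ j, ∑ p, ∑ q, A (i, j) (p, q) * ξ i * η j * ξ p * η q := fun ξ η =>
    le_trans (by positivity) (hA2 ξ η)
  have hAu := integral_inner_act_nonneg_of_mem_H10 hA hu.1
  have hweak := hu.2 u hu.1
  have hT : IsBddTensor fun x => tensEps a₁ a₀ ε x :=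
    ((isBddTensor_of_entries hcoeff.bdd₁).comp_smul hε1).add
      (((isBddTensor_of_entries hcoeff.bdd₀).comp_smul hε1).const_smul (ε ^ 2))
  have hsnd : MemLp u.snd 2 μ := Lp.memLp _
  have hfst : MemLp u.fst 2 μ := Lp.memLp _
  have i₁ : Integrable (fun x => inner ℝ (act (tensEps a₁ a₀ ε x) (u.snd x)) (u.snd x)) μ :=
    (hT.memLp_act hμ hsnd).integrable_inner_of_two hsnd
  have i₂ : Integrable (fun x => lam * ρ (ε⁻¹ • x) * inner ℝ (u.fst x) (u.fst x)) μ := by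
    have hm : AEStronglyMeasurable (fun x => lam * ρ (ε⁻¹ • x)) μ :=
      (((hρm.comp_quasiMeasurePreserving hq).mono_ac hμ).const_mul lam).aestronglyMeasurable
    refine (hfst.integrable_inner_of_two (𝕜 := ℝ) hfst).bdd_mul (c := |lam| * Cρ) hm ?_
    filter_upwards [hμ.ae_le (hq.ae hρC)] with x hx
    rw [norm_mul, Real.norm_eq_abs, Real.norm_eq_abs]
    exact mul_le_mul_of_nonneg_left hx (abs_nonneg _)
  have i₃ : Integrable (fun x => ‖v x‖ ^ 2) μ := (Lp.memLp v).integrable_norm_pow (by simp)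
  have i₄ : Integrable (fun x => inner ℝ (act A (u.snd x)) (u.snd x)) μ :=
    ((isBddTensor_const A).memLp_act hμ hsnd).integrable_inner_of_two hsnd
  have i₅ : Integrable (fun x => ‖u.fst x‖ ^ 2) μ := hfst.integrable_norm_pow (by simp)
  have j₁ : Integrable (fun x => 1 / 2 * ‖v x‖ ^ 2) μ := i₃.const_mul _
  have j₂ : Integrable (fun x => ε ^ 2 * inner ℝ (act A (u.snd x)) (u.snd x)) μ := i₄.const_mul _
  have j₁₂ : Integrable
      (fun x => 1 / 2 * ‖v x‖ ^ 2 + ε ^ 2 * inner ℝ (act A (u.snd x)) (u.snd x)) μ := j₁.add j₂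
  have j₃ : Integrable (fun x => lam * ν * ‖u.fst x‖ ^ 2) μ := i₅.const_mul _
  have hmono : ∫ x, (1 / 2 * ‖v x‖ ^ 2 + ε ^ 2 * inner ℝ (act A (u.snd x)) (u.snd x)
        + lam * ν * ‖u.fst x‖ ^ 2) ∂μ
      ≤ ∫ x, (inner ℝ (act (tensEps a₁ a₀ ε x) (u.snd x)) (u.snd x)
        + lam * ρ (ε⁻¹ • x) * inner ℝ (u.fst x) (u.fst x)) ∂μ := by
    refine integral_mono_ae (j₁₂.add j₃) (i₁.add i₂) ?_
    filter_upwards [hvae, hμ.ae_le (hq.ae hA1), hμ.ae_le (hq.ae hcoeff.symm₁),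
      hμ.ae_le (hq.ae hcoeff.nonneg₁), hμ.ae_le (hq.ae hcoeff.posρ)] with x hx hxA hxs hxp hxρ
    have h1 : ‖v x‖ ^ 2 = inner ℝ (act (a₁ (ε⁻¹ • x)) (u.snd x)) (u.snd x) := by
      rw [show v x = _ from hx, norm_act_tensSqrt_sq hxs hxp]
    have h2 := hxA (u.snd x)
    have h3 := hxp (u.snd x)
    have h4 : inner ℝ (act (tensEps a₁ a₀ ε x) (u.snd x)) (u.snd x)
        = (1 - ε ^ 2) * inner ℝ (act (a₁ (ε⁻¹ • x)) (u.snd x)) (u.snd x)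
          + ε ^ 2 * inner ℝ (act (a₀ (ε⁻¹ • x) + a₁ (ε⁻¹ • x)) (u.snd x)) (u.snd x) := by
      rw [tensEps, add_act, add_act, smul_act, inner_add_left, inner_add_left,
        real_inner_smul_left]
      ring
    rw [h4, h1, real_inner_self_eq_norm_sq]
    have h5 := mul_le_mul_of_nonneg_left h2 (sq_nonneg ε)
    have h6 : lam * ν * ‖u.fst x‖ ^ 2 ≤ lam * ρ (ε⁻¹ • x) * ‖u.fst x‖ ^ 2 := by gcongr
    nlinarith
  have hleft : ∫ x, (1 / 2 * ‖v x‖ ^ 2 + ε ^ 2 * inner ℝ (act A (u.snd x)) (u.snd x)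
        + lam * ν * ‖u.fst x‖ ^ 2) ∂μ
      = 1 / 2 * ‖v‖ ^ 2 + ε ^ 2 * ∫ x, inner ℝ (act A (u.snd x)) (u.snd x) ∂μ
        + lam * ν * ‖u.fst‖ ^ 2 := by
    rw [integral_add j₁₂ j₃, integral_add j₁ j₂, integral_const_mul, integral_const_mul,
      integral_const_mul, integral_norm_sq_eq, integral_norm_sq_eq]
  have hright : ∫ x, inner ℝ (f x) (u.fst x) ∂μ ≤ ‖f‖ * ‖u.fst‖ := by
    rw [← L2.inner_def]
    exact real_inner_le_norm _ _
  have htotal := hleft.symm.trans_le (hmono.trans (hweak.trans_le hright))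
  have hpos := mul_nonneg (sq_nonneg ε) hAu
  change 1 / 2 * ‖v‖ ^ 2 + _ ≤ _
  linarith

theorem exists_bound {n d : ℕ} {Ω : Set (Sp d)} {ν lam : ℝ} (hν : 0 < ν) (hlam : 0 < lam)
    {a₁ a₀ : Sp d → Tens n d} {ρ : Sp d → ℝ} (hcoeff : IsAdmissible ν a₁ a₀ ρ) (C : ℝ) :
    ∃ K : ℝ, ∀ (ε : ℝ) (hε : 0 < ε), ε ^ 2 ≤ 1 / 2 →
      ∀ (f : L2 (Vec n) ((volume : Measure (Sp d)).restrict Ω)), ‖f‖ ≤ C →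
      ∀ u : Pairs n ((volume : Measure (Sp d)).restrict Ω),
        IsWeakSolution Ω a₁ a₀ ρ lam ε f u →
        ‖u.fst‖ ≤ K ∧
        ‖mulTensor (hcoeff.isBddTensor_tensSqrt.comp_smul (inv_ne_zero hε.ne')) _
          Measure.absolutelyContinuous_restrict u.snd‖ ≤ K := by
  -- The first entry bounds `‖u‖`, on dividing the energy estimate by `‖u‖`; inserting it back on
  -- the right-hand side yields the second, for the weighted gradient.
  refine ⟨max (C / (lam * ν)) (√(2 * (C * (C / (lam * ν))))), ?_⟩
  intro ε hε hε' f hf u hu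
  have h := energy_estimate hν hlam hcoeff hε hε' hu
  have hln : 0 < lam * ν := mul_pos hlam hν
  have hC : 0 ≤ C := (norm_nonneg _).trans hf
  have h1 : ‖u.fst‖ ≤ C / (lam * ν) := by
    rw [le_div_iff₀ hln]
    rcases (norm_nonneg u.fst).eq_or_lt with h0 | h0
    · rw [← h0, zero_mul]; exact hC
    · refine le_of_mul_le_mul_right ?_ h0
      nlinarith [mul_le_mul_of_nonneg_right hf h0.le]
  refine ⟨h1.trans (le_max_left _ _), le_trans ?_ (le_max_right _ _)⟩
  refine Real.le_sqrt_of_sq_le ?_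
  have h2 : ‖f‖ * ‖u.fst‖ ≤ C * (C / (lam * ν)) := mul_le_mul hf h1 (norm_nonneg _) hC
  nlinarith [mul_nonneg hln.le (sq_nonneg ‖u.fst‖)]

/-! ### Weak convergence tested on a total set -/

/-- The vectors on which a bounded sequence of functionals converges to `T₀` form a closed subspace.
Totality of `D` is expressed by a trivial orthogonal complement, which for function spaces is the
fundamental lemma of the calculus of variations. -/
theorem tendsto_apply_of_total {H : Type*} [NormedAddCommGroup H] [InnerProductSpace ℝ H]
    [CompleteSpace H] {T : ℕ → H →L[ℝ] ℝ} {T₀ : H →L[ℝ] ℝ} {C : ℝ}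
    (hC : ∀ᶠ k in atTop, ‖T k‖ ≤ C) {D : Set H}
    (hD : ∀ c : H, (∀ φ ∈ D, inner ℝ c φ = 0) → c = 0)
    (h : ∀ φ ∈ D, Tendsto (fun k => T k φ) atTop (𝓝 (T₀ φ))) (x : H) :
    Tendsto (fun k => T k x) atTop (𝓝 (T₀ x)) := by
  let S : Submodule ℝ H :=
    { carrier := {x | Tendsto (fun k => T k x) atTop (𝓝 (T₀ x))}
      add_mem' := fun {x y} hx hy => by
        simpa only [Set.mem_ofPred_eq, map_add] using hx.add hy
      zero_mem' := by simp
      smul_mem' := fun c x hx => by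
        simpa only [Set.mem_ofPred_eq, map_smul] using hx.const_smul c }
  have hdense : S.topologicalClosure = ⊤ := by
    rw [Submodule.topologicalClosure_eq_top_iff, Submodule.eq_bot_iff]
    intro c hc
    refine hD c fun φ hφ => ?_
    rw [real_inner_comm]
    exact (Submodule.mem_orthogonal _ _).1 hc φ (h φ hφ)
  have hx : x ∈ S.topologicalClosure := hdense ▸ Submodule.mem_top
  have hC0 : 0 ≤ C := by
    obtain ⟨k, hk⟩ := hC.exists
    exact (norm_nonneg _).trans hk
  rw [Metric.tendsto_nhds]
  intro δ hδ
  -- The errors of `T k` and `T₀` at `x - z` then add up to less than `δ / 2`; the summand `1` keeps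
  -- the denominator positive.
  obtain ⟨z, hz, hxz⟩ := Metric.mem_closure_iff.1 hx (δ / (2 * (C + ‖T₀‖ + 1))) (by positivity)
  filter_upwards [hC, Metric.tendsto_nhds.1 hz (δ / 2) (by positivity)] with k hk hkz
  have h1 : ‖T k (x - z)‖ ≤ C * ‖x - z‖ := (T k).le_of_opNorm_le hk _
  have h2 : ‖T₀ (x - z)‖ ≤ ‖T₀‖ * ‖x - z‖ := T₀.le_opNorm _
  rw [dist_eq_norm] at hxz hkz ⊢
  have h3 : (C + ‖T₀‖ + 1) * ‖x - z‖ < δ / 2 := by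
    rw [lt_div_iff₀ (by positivity)] at hxz
    linarith
  have h4 : T k x - T₀ x = T k (x - z) + (T k z - T₀ z) - T₀ (x - z) := by
    simp only [map_sub]; ring
  rw [h4]
  have h5 := norm_sub_le (T k (x - z) + (T k z - T₀ z)) (T₀ (x - z))
  have h6 := norm_add_le (T k (x - z)) (T k z - T₀ z)
  have := norm_nonneg (x - z)
  linarith

/-! ### Oscillating test fields -/

/-- The point is that `K` depends neither on `ε` nor on `b`, which makes density arguments in `b`
uniform along the sequence. -/
theorem exists_eLpNorm_oscillating_le {d : ℕ} {F : Type*} [NormedAddCommGroup F] [NormedSpace ℝ F]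
    {φ : Sp d → ℝ} (hφ : Continuous φ) (hφc : HasCompactSupport φ) :
    ∃ K : NNReal, ∀ ε : ℝ, 0 < ε → ε ≤ 1 → ∀ b : Sp d → F, MemLp b 2 (cellMeas d) →
      MemLp (fun x => φ x • b (frac (ε⁻¹ • x))) 2 volume ∧
      eLpNorm (fun x => φ x • b (frac (ε⁻¹ • x))) 2 volume ≤ K * eLpNorm b 2 (cellMeas d) := by
  obtain ⟨D, hD0, hD⟩ := exists_norm_le_openCell d
  obtain ⟨B, hB⟩ := hφc.exists_bound_of_continuous hφ
  obtain ⟨R, hR⟩ := hφc.isCompact.isBounded.subset_ball (0 : Sp d)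
  -- The averaging estimate needs radius `R + ε D`, and `ε ≤ 1`.
  let V : ENNReal := volume (Metric.ball (0 : Sp d) (R + D))
  have hV : V ≠ ⊤ := measure_ball_lt_top.ne
  have hV' : V ^ (1 / (2 : ENNReal)).toReal ≠ ⊤ := ENNReal.rpow_ne_top_of_nonneg (by positivity) hV
  refine ⟨B.toNNReal * (V ^ (1 / (2 : ENNReal)).toReal).toNNReal, fun ε hε hε1 b hb => ?_⟩
  have hε' : ε⁻¹ ≠ 0 := inv_ne_zero hε.ne'
  have hm : Measurable fun x : Sp d => frac (ε⁻¹ • x) :=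
    measurable_frac.comp (measurable_const_smul _)
  have hle : (volume.restrict (Metric.ball (0 : Sp d) R)).map (fun x => frac (ε⁻¹ • x))
      ≤ V • cellMeas d := by
    refine (map_frac_smul_restrict_ball_le hD R hε').trans ?_
    rw [inv_inv, abs_of_pos hε]
    refine Measure.le_iff.2 fun s _ => ?_
    rw [Measure.smul_apply, Measure.smul_apply]
    refine mul_le_mul_left (measure_mono (Metric.ball_subset_ball ?_)) _
    nlinarith
  have hb' := MemLp.of_measure_le_smul hV hle hb
  have hball : MemLp (fun x => b (frac (ε⁻¹ • x))) 2 (volume.restrict (Metric.ball 0 R)) :=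
    hb'.comp_of_map hm.aemeasurable
  have hnorm : eLpNorm (fun x => b (frac (ε⁻¹ • x))) 2 (volume.restrict (Metric.ball 0 R))
      ≤ V ^ (1 / (2 : ENNReal)).toReal * eLpNorm b 2 (cellMeas d) := by
    have h1 := eLpNorm_map_measure (p := 2) hb'.aestronglyMeasurable hm.aemeasurable
    have h2 := eLpNorm_smul_measure_of_ne_top (μ := cellMeas d) (p := 2) (by simp) b V
    rw [smul_eq_mul] at h2
    rw [← h2]
    exact h1.symm.trans_le (eLpNorm_mono_measure b hle)
  have hsupp : Function.support (fun x => φ x • b (frac (ε⁻¹ • x))) ⊆ Metric.ball 0 R :=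
    (Function.support_smul_subset_left _ _).trans ((subset_tsupport φ).trans hR)
  have hpt : ∀ x, ‖φ x • b (frac (ε⁻¹ • x))‖ ≤ B * ‖b (frac (ε⁻¹ • x))‖ := fun x => by
    rw [norm_smul]
    exact mul_le_mul_of_nonneg_right (hB x) (norm_nonneg _)
  have hfin := eLpNorm_le_mul_eLpNorm_of_ae_le_mul (μ := volume.restrict (Metric.ball 0 R))
    (ae_of_all _ hpt) 2
  rw [eLpNorm_restrict_eq_of_support_subset hsupp] at hfin
  have hbound : eLpNorm (fun x => φ x • b (frac (ε⁻¹ • x))) 2 volume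
      ≤ (B.toNNReal * (V ^ (1 / (2 : ENNReal)).toReal).toNNReal : NNReal)
        * eLpNorm b 2 (cellMeas d) := by
    refine hfin.trans ?_
    rw [ENNReal.coe_mul, ENNReal.coe_toNNReal hV', mul_assoc]
    exact mul_le_mul_right hnorm _
  refine ⟨⟨?_, hbound.trans_lt (ENNReal.mul_lt_top ENNReal.coe_lt_top hb.2)⟩, hbound⟩
  exact hφ.aestronglyMeasurable.smul
    (hb.aestronglyMeasurable.comp_quasiMeasurePreserving (quasiMeasurePreserving_frac_smul hε'))

theorem memLp_oscillating {d : ℕ} {F : Type*} [NormedAddCommGroup F] [NormedSpace ℝ F]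
    {φ : Sp d → ℝ} (hφ : Continuous φ) (hφc : HasCompactSupport φ) {ε : ℝ} (hε : 0 < ε)
    (hε1 : ε ≤ 1) {b : Sp d → F} (hb : MemLp b 2 (cellMeas d)) (Ω : Set (Sp d)) :
    MemLp (fun x => φ x • b (frac (ε⁻¹ • x))) 2 (volume.restrict Ω) := by
  obtain ⟨K, hK⟩ := exists_eLpNorm_oscillating_le (F := F) hφ hφc
  exact ((hK ε hε hε1 b hb).1).restrict Ω

theorem exists_norm_toLp_oscillating_le {d : ℕ} {F : Type} [NormedAddCommGroup F]
    [NormedSpace ℝ F] {φ : Sp d → ℝ} (hφ : Continuous φ) (hφc : HasCompactSupport φ)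
    (Ω : Set (Sp d)) : ∃ K : ℝ, ∀ (ε : ℝ) (hε : 0 < ε) (hε1 : ε ≤ 1) (b : L2 F (cellMeas d)),
      ‖(memLp_oscillating hφ hφc hε hε1 (Lp.memLp b) Ω).toLp _‖ ≤ K * ‖b‖ := by
  obtain ⟨K, hK⟩ := exists_eLpNorm_oscillating_le (F := F) hφ hφc
  refine ⟨K, fun ε hε hε1 b => ?_⟩
  have h := (eLpNorm_mono_measure (fun x => φ x • b (frac (ε⁻¹ • x)))
    (Measure.restrict_le_self (s := Ω) (μ := volume))).trans (hK ε hε hε1 b (Lp.memLp b)).2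
  have h2 := ENNReal.toReal_mono (ENNReal.mul_ne_top ENNReal.coe_ne_top (Lp.eLpNorm_ne_top b)) h
  rw [ENNReal.toReal_mul, ENNReal.coe_toReal] at h2
  exact (Lp.norm_toLp _ _).trans_le h2

/-- The map `b ↦ φ(x) b(x/ε)`. -/
noncomputable def oscillating {d : ℕ} {F : Type} [NormedAddCommGroup F] [NormedSpace ℝ F]
    {φ : Sp d → ℝ} (hφ : Continuous φ) (hφc : HasCompactSupport φ) {ε : ℝ} (hε : 0 < ε)
    (hε1 : ε ≤ 1) (Ω : Set (Sp d)) : L2 F (cellMeas d) →L[ℝ] L2 F (volume.restrict Ω) :=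
  LinearMap.mkContinuousOfExistsBound
    { toFun := fun b => (memLp_oscillating hφ hφc hε hε1 (Lp.memLp b) Ω).toLp _
      map_add' := fun b b' => by
        rw [← MemLp.toLp_add]
        refine MemLp.toLp_congr _ _ ?_
        filter_upwards [(quasiMeasurePreserving_frac_smul_restrict
          (inv_ne_zero hε.ne') Ω).ae (Lp.coeFn_add b b')] with x hx
        rw [hx, Pi.add_apply, smul_add]
        rfl
      map_smul' := fun c b => by
        rw [← MemLp.toLp_const_smul]
        refine MemLp.toLp_congr _ _ ?_
        filter_upwards [(quasiMeasurePreserving_frac_smul_restrict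
          (inv_ne_zero hε.ne') Ω).ae (Lp.coeFn_smul c b)] with x hx
        rw [hx, Pi.smul_apply, smul_comm]
        rfl }
    ((exists_norm_toLp_oscillating_le hφ hφc Ω).imp fun _ hK b => hK ε hε hε1 b)

theorem oscillating_coeFn {d : ℕ} {F : Type} [NormedAddCommGroup F] [NormedSpace ℝ F]
    {φ : Sp d → ℝ} (hφ : Continuous φ) (hφc : HasCompactSupport φ) {ε : ℝ} (hε : 0 < ε)
    (hε1 : ε ≤ 1) (Ω : Set (Sp d)) (b : L2 F (cellMeas d)) :
    oscillating hφ hφc hε hε1 Ω b =ᵐ[volume.restrict Ω] fun x => φ x • b (frac (ε⁻¹ • x)) :=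
  (memLp_oscillating hφ hφc hε hε1 (Lp.memLp b) Ω).coeFn_toLp

theorem exists_norm_oscillating_le {d : ℕ} {F : Type} [NormedAddCommGroup F] [NormedSpace ℝ F]
    {φ : Sp d → ℝ} (hφ : Continuous φ) (hφc : HasCompactSupport φ) (Ω : Set (Sp d)) :
    ∃ K : ℝ, ∀ (ε : ℝ) (hε : 0 < ε) (hε1 : ε ≤ 1),
      ‖(oscillating hφ hφc hε hε1 Ω : L2 F (cellMeas d) →L[ℝ] _)‖ ≤ K := by
  obtain ⟨K, hK⟩ := exists_norm_toLp_oscillating_le (F := F) hφ hφc Ω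
  refine ⟨max K 0, fun ε hε hε1 =>
    ContinuousLinearMap.opNorm_le_bound _ (le_max_right _ _) fun b => (hK ε hε hε1 b).trans ?_⟩
  exact mul_le_mul_of_nonneg_right (le_max_left _ _) (norm_nonneg _)

/-! ### Two-scale convergence against non-smooth test functions -/

theorem IsPer.exists_bound {d : ℕ} {F : Type*} [NormedAddCommGroup F] {g : Sp d → F}
    (hg : IsPer g) (hc : Continuous g) : ∃ B : ℝ, ∀ y, ‖g y‖ ≤ B := by
  obtain ⟨B, hB⟩ := (isCompact_cell d).exists_bound_of_continuousOn hc.continuousOn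
  exact ⟨B, fun y => hg.comp_frac y ▸ hB _ (openCell_subset_cell d (frac_mem_openCell y))⟩

theorem memLp_cell_of_continuous {d : ℕ} {F : Type*} [NormedAddCommGroup F] {g : Sp d → F}
    (hc : Continuous g) : MemLp g 2 (cellMeas d) := by
  obtain ⟨B, hB⟩ := (isCompact_cell d).exists_bound_of_continuousOn hc.continuousOn
  refine MemLp.of_bound hc.aestronglyMeasurable B ?_
  exact (ae_restrict_mem (isCompact_cell d).measurableSet).mono hB

theorem eq_zero_of_inner_contDiff {d : ℕ} {Ω : Set (Sp d)} (hΩ : IsOpen Ω)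
    (c : L2 ℝ ((volume : Measure (Sp d)).restrict Ω))
    (h : ∀ φ : L2 ℝ ((volume : Measure (Sp d)).restrict Ω),
      (∃ θ : Sp d → ℝ, ContDiff ℝ ∞ θ ∧ HasCompactSupport θ ∧ tsupport θ ⊆ Ω ∧
        φ =ᵐ[volume.restrict Ω] θ) → inner ℝ c φ = 0) : c = 0 := by
  rw [Lp.eq_zero_iff_ae_eq_zero, EventuallyEq, ae_restrict_iff' hΩ.measurableSet]
  have hloc : LocallyIntegrableOn c Ω volume :=
    locallyIntegrableOn_of_locallyIntegrable_restrict ((Lp.memLp c).locallyIntegrable (by simp))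
  refine hΩ.ae_eq_zero_of_integral_contDiff_smul_eq_zero hloc fun θ hθ hc hs => ?_
  have hm : MemLp θ 2 ((volume : Measure (Sp d)).restrict Ω) :=
    hθ.continuous.memLp_of_hasCompactSupport hc
  have := h (hm.toLp θ) ⟨θ, hθ, hc, hs, hm.coeFn_toLp⟩
  have hsupp : Function.support (fun x => θ x • c x) ⊆ Ω :=
    (Function.support_smul_subset_left θ c).trans ((subset_tsupport θ).trans hs)
  rw [← setIntegral_eq_integral_of_tsupport_subset hsupp, ← this, L2.inner_def]
  refine integral_congr_ae ?_
  filter_upwards [hm.coeFn_toLp] with x hx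
  rw [hx, RCLike.inner_apply, conj_trivial, smul_eq_mul]

/-- By unfolding, pairing `c` with the periodization of `θ` on the cell tests its periodic extension
against `θ` on `ℝ^d`. The extension therefore vanishes as a distribution. -/
theorem eq_zero_of_inner_periodize {d : ℕ} {F : Type} [NormedAddCommGroup F]
    [InnerProductSpace ℝ F] [CompleteSpace F] (c : L2 F (cellMeas d))
    (h : ∀ b : L2 F (cellMeas d), (∃ (θ : Sp d → ℝ) (e : F), ContDiff ℝ ∞ θ ∧
      HasCompactSupport θ ∧ b =ᵐ[cellMeas d] fun y => periodize θ y • e) → inner ℝ c b = 0) :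
    c = 0 := by
  have hint : Integrable c (cellMeas d) := (Lp.memLp c).integrable (by norm_num)
  have h0 : ∀ᵐ y ∂(volume : Measure (Sp d)), c (frac y) = 0 := by
    refine ae_eq_zero_of_integral_contDiff_smul_eq_zero (locallyIntegrable_comp_frac hint)
      fun θ hθ hc => ?_
    rw [integral_smul_comp_frac hθ.continuous hc hint]
    have hp := Continuous.periodize hθ.continuous hc
    have hpc : MemLp (periodize θ) 2 (cellMeas d) := memLp_cell_of_continuous hp
    have hi : Integrable (fun y => periodize θ y • c y) (cellMeas d) := by
      obtain ⟨B, hB⟩ := (isPer_periodize θ).exists_bound hp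
      exact hint.bdd_smul B hp.aestronglyMeasurable (ae_of_all _ hB)
    refine ext_inner_left ℝ fun e => ?_
    rw [← integral_inner hi, inner_zero_right]
    have hm : MemLp (fun y => periodize θ y • e) 2 (cellMeas d) :=
      memLp_cell_of_continuous (hp.smul continuous_const)
    rw [← h (hm.toLp _) ⟨θ, e, hθ, hc, hm.coeFn_toLp⟩, L2.inner_def]
    refine integral_congr_ae ?_
    filter_upwards [hm.coeFn_toLp] with y hy
    rw [hy, inner_smul_right, inner_smul_right, real_inner_comm]
  rw [Lp.eq_zero_iff_ae_eq_zero]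
  filter_upwards [frac_ae_eq_id d, ae_restrict_of_ae h0] with y h1 h2
  rw [← h1, h2, Pi.zero_apply]

/-- First enlargement of the test class: with `g` fixed, the functions `x ↦ v k x · g(x/ε)` are
bounded in `L²(Ω)`, and functions smooth with compact support in `Ω` are total there. The slow
factor need no longer vanish near `∂Ω`. -/
theorem TwoScaleTendsto.tendsto_of_periodic {d : ℕ} {F : Type} [NormedAddCommGroup F]
    [InnerProductSpace ℝ F] {Ω : Set (Sp d)} (hΩ : IsOpen Ω) {ε : ℕ → ℝ}
    {v : ℕ → L2 F (volume.restrict Ω)} {C : ℝ} (hv : ∀ᶠ k in atTop, ‖v k‖ ≤ C)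
    {v₀ : Sp d → L2 F (cellMeas d)} (hv₀ : MemLp v₀ 2 (volume.restrict Ω))
    (h : TwoScaleTendsto Ω ε (fun k => v k) v₀) {g : Sp d → F} (hg : ContDiff ℝ ∞ g)
    (hgp : IsPer g) (φ : L2 ℝ (volume.restrict Ω)) :
    Tendsto (fun k => ∫ x in Ω, inner ℝ (v k x) (g ((ε k)⁻¹ • x)) * φ x) atTop
      (𝓝 (∫ x in Ω, (∫ y in cell d, inner ℝ (v₀ x y) (g y)) * φ x)) := by
  obtain ⟨B, hB⟩ := hgp.exists_bound hg.continuous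
  have hB0 : 0 ≤ B := (norm_nonneg _).trans (hB 0)
  have hle : ∀ k x, ‖inner ℝ (v k x) (g ((ε k)⁻¹ • x))‖ ≤ B * ‖v k x‖ := fun k x => by
    refine (norm_inner_le_norm _ _).trans ?_
    rw [mul_comm]
    exact mul_le_mul_of_nonneg_right (hB _) (norm_nonneg _)
  have hm : ∀ k, MemLp (fun x => inner ℝ (v k x) (g ((ε k)⁻¹ • x))) 2 (volume.restrict Ω) :=
    fun k => (Lp.memLp (v k)).of_le_mul (c := B) ((Lp.memLp (v k)).aestronglyMeasurable.inner
      (hg.continuous.comp (continuous_const_smul _)).aestronglyMeasurable) (ae_of_all _ (hle k))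
  have hgm : MemLp g 2 (cellMeas d) := memLp_cell_of_continuous hg.continuous
  have hin : ∀ x, ∫ y in cell d, inner ℝ (v₀ x y) (g y) = inner ℝ (hgm.toLp g) (v₀ x) := by
    intro x
    rw [L2.inner_def]
    refine integral_congr_ae ?_
    filter_upwards [hgm.coeFn_toLp] with y hy
    rw [hy, real_inner_comm]
  have hm₀ : MemLp (fun x => ∫ y in cell d, inner ℝ (v₀ x y) (g y)) 2 (volume.restrict Ω) := by
    simp only [hin]
    exact (innerSL ℝ (hgm.toLp g)).comp_memLp' hv₀
  have hmul : ∀ (w : Sp d → ℝ) (hw : MemLp w 2 (volume.restrict Ω))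
      (ψ : L2 ℝ (volume.restrict Ω)), inner ℝ (hw.toLp w) ψ = ∫ x in Ω, w x * ψ x := by
    intro w hw ψ
    rw [L2.inner_def]
    refine integral_congr_ae ?_
    filter_upwards [hw.coeFn_toLp] with x hx
    rw [hx, RCLike.inner_apply, conj_trivial, mul_comm]
  have key := tendsto_apply_of_total (T := fun k => innerSL ℝ ((hm k).toLp _))
    (T₀ := innerSL ℝ (hm₀.toLp _)) (C := B * C) ?_ (eq_zero_of_inner_contDiff hΩ) ?_ φ
  · simpa only [innerSL_apply_apply, hmul] using key
  · filter_upwards [hv] with k hk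
    rw [innerSL_apply_norm]
    refine (Lp.norm_le_mul_norm_of_ae_le_mul (c := B) (g := v k) ?_).trans
      (mul_le_mul_of_nonneg_left hk hB0)
    filter_upwards [(hm k).coeFn_toLp] with x hx
    rw [hx]
    exact hle k x
  · rintro ψ ⟨θ, hθ, hc, hs, hψ⟩
    simp only [innerSL_apply_apply, hmul]
    have htest : IsTwoScaleTest Ω fun p : Sp d × Sp d => θ p.1 • g p.2 :=
      ⟨(hθ.comp contDiff_fst).smul (hg.comp contDiff_snd), fun x j y => by simp only [hgp j y],
        tsupport θ, hc.isCompact, hs, fun x hx y => by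
          simp only [image_eq_zero_of_notMem_tsupport hx, zero_smul]⟩
    have := h _ htest
    convert! this using 2
    · refine integral_congr_ae ?_
      filter_upwards [hψ] with x hx
      rw [hx, inner_smul_right, mul_comm]
    · refine integral_congr_ae ?_
      filter_upwards [hψ] with x hx
      simp only [inner_smul_right]
      rw [hx, integral_const_mul, mul_comm]

/-- Second enlargement: with the slow factor fixed, the pairings are functionals of `b ∈ L²(Q)`,
bounded uniformly in `k`, and smooth periodic `b` are total. Arbitrary elements of `W` thus become
admissible fast factors. -/
theorem TwoScaleTendsto.tendsto_oscillating {d : ℕ} {F : Type} [NormedAddCommGroup F]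
    [InnerProductSpace ℝ F] [CompleteSpace F] {Ω : Set (Sp d)} (hΩ : IsOpen Ω) {ε : ℕ → ℝ}
    (hε : ∀ k, 0 < ε k) (hε0 : Tendsto ε atTop (𝓝 0))
    {v : ℕ → L2 F (volume.restrict Ω)} {C : ℝ} (hv : ∀ᶠ k in atTop, ‖v k‖ ≤ C)
    {v₀ : Sp d → L2 F (cellMeas d)} (hv₀ : MemLp v₀ 2 (volume.restrict Ω))
    (h : TwoScaleTendsto Ω ε (fun k => v k) v₀) {φ : Sp d → ℝ} (hφ : Continuous φ)
    (hφc : HasCompactSupport φ) (b : L2 F (cellMeas d)) :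
    Tendsto (fun k => ∫ x in Ω, inner ℝ (v k x) (φ x • b (frac ((ε k)⁻¹ • x)))) atTop
      (𝓝 (∫ x in Ω, φ x * inner ℝ (v₀ x) b)) := by
  classical
  have hsmall : ∀ᶠ k in atTop, ε k ≤ 1 := (hε0.eventually_le_const one_pos)
  obtain ⟨K, hK⟩ := exists_norm_oscillating_le (F := F) hφ hφc Ω
  -- The value `0` is harmless: `ε k ≤ 1` for all large `k`.
  let P : ℕ → L2 F (cellMeas d) →L[ℝ] L2 F (volume.restrict Ω) := fun k =>
    if h1 : ε k ≤ 1 then oscillating hφ hφc (hε k) h1 Ω else 0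
  have hP : ∀ k, ε k ≤ 1 → ∀ b, innerSL ℝ (v k) (P k b)
      = ∫ x in Ω, inner ℝ (v k x) (φ x • b (frac ((ε k)⁻¹ • x))) := by
    intro k hk b
    simp only [P, dif_pos hk, innerSL_apply_apply, L2.inner_def]
    refine integral_congr_ae ?_
    filter_upwards [oscillating_coeFn hφ hφc (hε k) hk Ω b] with x hx
    rw [hx]
  have hφm : MemLp φ 2 ((volume : Measure (Sp d)).restrict Ω) :=
    hφ.memLp_of_hasCompactSupport hφc
  have hint : Integrable (fun x => φ x • v₀ x) (volume.restrict Ω) :=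
    memLp_one_iff_integrable.1 (hv₀.smul hφm)
  have hT₀ : ∀ b, innerSL ℝ (∫ x in Ω, φ x • v₀ x) b = ∫ x in Ω, φ x * inner ℝ (v₀ x) b := by
    intro b
    rw [innerSL_apply_apply, real_inner_comm, ← integral_inner hint]
    refine integral_congr_ae (ae_of_all _ fun x => ?_)
    dsimp only
    rw [inner_smul_right, real_inner_comm]
  have key := tendsto_apply_of_total (T := fun k => (innerSL ℝ (v k)).comp (P k))
    (T₀ := innerSL ℝ (∫ x in Ω, φ x • v₀ x)) (C := C * K) ?_ eq_zero_of_inner_periodize ?_ b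
  · rw [hT₀] at key
    refine key.congr' ?_
    filter_upwards [hsmall] with k hk
    rw [ContinuousLinearMap.comp_apply, hP k hk]
  · filter_upwards [hv, hsmall] with k hk hk1
    refine (ContinuousLinearMap.opNorm_comp_le _ _).trans ?_
    rw [innerSL_apply_norm]
    refine mul_le_mul hk ?_ (norm_nonneg _) ((norm_nonneg _).trans hk)
    simp only [P, dif_pos hk1]
    exact hK _ _ _
  · rintro b' ⟨θ, e, hθ, hc, hb'⟩
    have hgs : ContDiff ℝ ∞ fun y => periodize θ y • e :=
      (ContDiff.periodize hθ hc).smul contDiff_const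
    have hgp : IsPer fun y => periodize θ y • e := fun j y => by
      simp only [isPer_periodize θ j y]
    have := h.tendsto_of_periodic hΩ hv hv₀ hgs hgp (hφm.toLp φ)
    rw [hT₀]
    convert! this.congr' ?_ using 2
    · refine integral_congr_ae ?_
      filter_upwards [hφm.coeFn_toLp] with x hx
      rw [hx, mul_comm, L2.inner_def]
      congr 1
      refine integral_congr_ae ?_
      filter_upwards [hb'] with y hy
      rw [hy]
    · filter_upwards [hsmall] with k hk
      rw [ContinuousLinearMap.comp_apply, hP k hk]
      refine integral_congr_ae ?_
      filter_upwards [hφm.coeFn_toLp, (quasiMeasurePreserving_frac_smul_restrict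
        (inv_ne_zero (hε k).ne') Ω).ae hb'] with x hx hx'
      rw [hx, hx', (isPer_periodize θ).comp_frac, inner_smul_right (v k x) _ (φ x), mul_comm]

/-! ### Divergence-free periodic fields and integration by parts -/

/-- The partial derivative `∂φ/∂x_j` of a scalar function. -/
noncomputable def pderiv {d : ℕ} (φ : Sp d → ℝ) (j : Fin d) (x : Sp d) : ℝ :=
  fderiv ℝ φ x (basisVec d j)

theorem continuous_pderiv {d : ℕ} {φ : Sp d → ℝ} (hφ : ContDiff ℝ ∞ φ) (j : Fin d) :
    Continuous (pderiv φ j) :=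
  (hφ.continuous_fderiv (by simp)).clm_apply continuous_const

theorem hasCompactSupport_pderiv {d : ℕ} {φ : Sp d → ℝ} (hφ : HasCompactSupport φ) (j : Fin d) :
    HasCompactSupport (pderiv φ j) :=
  hφ.fderiv_apply ℝ _

theorem isPer_pderiv {d : ℕ} {φ : Sp d → ℝ} (hφ : IsPer φ) (j : Fin d) : IsPer (pderiv φ j) := by
  intro l y
  have : (fun z => φ (z + basisVec d l)) = φ := funext (hφ l)
  rw [pderiv, pderiv, ← fderiv_comp_add_right, this]

/-- `div_y B = 0` on the periodicity torus. -/
def IsDivFree {n d : ℕ} (B : L2 (Mat n d) (cellMeas d)) : Prop :=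
  ∀ w ∈ H1per n d, ∫ y in cell d, inner ℝ (B y) (w.snd y) = 0

/-- Unfolding moves the integrals from the cell to `ℝ^d`, where `θ` has compact support and ordinary
integration by parts applies; folding back gives the claim. Periodizations thereby become legitimate
elements of `H^1_#`. -/
theorem isWeakGradPer_periodize {n d : ℕ} {θ : Sp d → Vec n} (hθ : ContDiff ℝ ∞ θ)
    (hc : HasCompactSupport θ) {v : L2 (Vec n) (cellMeas d)} {g : L2 (Mat n d) (cellMeas d)}
    (hv : v =ᵐ[cellMeas d] fun y => WithLp.toLp 2 fun i => periodize (fun z => θ z i) y)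
    (hg : g =ᵐ[cellMeas d] fun y => WithLp.toLp 2 fun I => periodize (fun z => grad θ z I) y) :
    IsWeakGradPer v g := by
  intro ψ hψ hψp i j
  have hθi : ContDiff ℝ ∞ fun z => θ z i :=
    (EuclideanSpace.proj i : Vec n →L[ℝ] ℝ).contDiff.comp hθ
  have hci : HasCompactSupport fun z => θ z i :=
    hc.comp_left (g := fun w : Vec n => w i) (by simp)
  have hgi : ∀ z, grad θ z (i, j) = pderiv (fun z => θ z i) j z := fun z =>
    grad_apply' (hθ.differentiable (by simp) z) (i, j)
  have hcψ : Integrable ψ (cellMeas d) :=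
    (memLp_cell_of_continuous hψ.continuous).integrable (by norm_num)
  have hcψ' : Integrable (pderiv ψ j) (cellMeas d) :=
    (memLp_cell_of_continuous (continuous_pderiv hψ j)).integrable (by norm_num)
  have hci' := hasCompactSupport_pderiv hci j
  calc ∫ y in cell d, v y i * fderiv ℝ ψ y (basisVec d j)
      = ∫ y in cell d, periodize (fun z => θ z i) y • pderiv ψ j y := by
        refine integral_congr_ae ?_
        filter_upwards [hv] with y hy
        rw [hy, smul_eq_mul, pderiv]
    _ = ∫ y, θ y i • pderiv ψ j y := by
        rw [← integral_smul_comp_frac hθi.continuous hci hcψ']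
        simp only [(isPer_pderiv hψp j).comp_frac]
    _ = - ∫ y, pderiv (fun z => θ z i) j y • ψ y := by
        simp only [smul_eq_mul, pderiv]
        refine integral_mul_fderiv_eq_neg_fderiv_mul_of_integrable ?_ ?_ ?_
          (fun x _ => hθi.differentiable (by simp) x) (fun x _ => hψ.differentiable (by simp) x)
        · exact ((continuous_pderiv hθi j).mul hψ.continuous).integrable_of_hasCompactSupport
            hci'.mul_right
        · exact (hθi.continuous.mul (continuous_pderiv hψ j)).integrable_of_hasCompactSupport
            hci.mul_right
        · exact (hθi.continuous.mul hψ.continuous).integrable_of_hasCompactSupport hci.mul_right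
    _ = - ∫ y in cell d, periodize (pderiv (fun z => θ z i) j) y • ψ y := by
        rw [← integral_smul_comp_frac (continuous_pderiv hθi j) hci' hcψ]
        simp only [hψp.comp_frac]
    _ = - ∫ y in cell d, g y (i, j) * ψ y := by
        congr 1
        refine integral_congr_ae ?_
        filter_upwards [hg] with y hy
        rw [hy, smul_eq_mul]
        simp only [hgi]

/-- Divergence-free on the torus implies divergence-free on `ℝ^d` in the sense of distributions:
folding the integral over the lattice turns `grad θ` into the gradient of the periodization of `θ`,
an admissible periodic test function. -/
theorem IsDivFree.integral_grad_eq_zero {n d : ℕ} {B : L2 (Mat n d) (cellMeas d)}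
    (hB : IsDivFree B) {θ : Sp d → Vec n} (hθ : ContDiff ℝ ∞ θ) (hc : HasCompactSupport θ) :
    ∫ y, inner ℝ (grad θ y) (B (frac y)) = 0 := by
  have hgc : ∀ I, Continuous fun z => grad θ z I := fun I =>
    (EuclideanSpace.proj I : Mat n d →L[ℝ] ℝ).continuous.comp (continuous_grad hθ)
  have hgs : ∀ I, HasCompactSupport fun z => grad θ z I := fun I =>
    (hasCompactSupport_grad hc).comp_left (g := fun w : Mat n d => w I) (by simp)
  have hci : ∀ i, HasCompactSupport fun z => θ z i := fun i =>
    hc.comp_left (g := fun w : Vec n => w i) (by simp)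
  have hm₁ : MemLp (fun y => (WithLp.toLp 2 fun i => periodize (fun z => θ z i) y : Vec n)) 2
      (cellMeas d) := by
    refine memLp_cell_of_continuous ((PiLp.continuous_toLp 2 _).comp (continuous_pi fun i => ?_))
    exact Continuous.periodize
      ((EuclideanSpace.proj i : Vec n →L[ℝ] ℝ).continuous.comp hθ.continuous) (hci i)
  have hm₂ : MemLp (fun y => (WithLp.toLp 2 fun I => periodize (fun z => grad θ z I) y : Mat n d))
      2 (cellMeas d) := by
    refine memLp_cell_of_continuous ((PiLp.continuous_toLp 2 _).comp (continuous_pi fun I => ?_))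
    exact Continuous.periodize (hgc I) (hgs I)
  have h0 := hB (WithLp.toLp 2 (hm₁.toLp _, hm₂.toLp _))
    (isWeakGradPer_periodize hθ hc hm₁.coeFn_toLp hm₂.coeFn_toLp)
  have hBI : ∀ I, Integrable (fun y => B y I) (cellMeas d) := fun I =>
    ((EuclideanSpace.proj I : Mat n d →L[ℝ] ℝ).comp_memLp' (Lp.memLp B)).integrable (by norm_num)
  have hper : ∀ I, Continuous (periodize fun z => grad θ z I) := fun I =>
    Continuous.periodize (hgc I) (hgs I)
  rw [← h0]
  calc ∫ y, inner ℝ (grad θ y) (B (frac y)) = ∫ y, ∑ I, grad θ y I • B (frac y) I := by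
        simp only [PiLp.inner_apply, RCLike.inner_apply, conj_trivial, smul_eq_mul, mul_comm]
    _ = ∑ I, ∫ y, grad θ y I • B (frac y) I := by
        refine integral_finsetSum _ fun I _ => ?_
        exact (locallyIntegrable_comp_frac (hBI I)).integrable_smul_left_of_hasCompactSupport
          (hgc I) (hgs I)
    _ = ∑ I, ∫ y in cell d, periodize (fun z => grad θ z I) y • B y I :=
        Finset.sum_congr rfl fun I _ => integral_smul_comp_frac (hgc I) (hgs I) (hBI I)
    _ = ∫ y in cell d, ∑ I, periodize (fun z => grad θ z I) y • B y I := by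
        refine (integral_finsetSum _ fun I _ => ?_).symm
        obtain ⟨K, hK⟩ := (isPer_periodize fun z => grad θ z I).exists_bound (hper I)
        exact (hBI I).bdd_smul K (hper I).aestronglyMeasurable (ae_of_all _ hK)
    _ = _ := by
        refine integral_congr_ae ?_
        filter_upwards [hm₂.coeFn_toLp] with y hy
        rw [show (WithLp.toLp 2 (hm₁.toLp _, hm₂.toLp _) : Pairs n (cellMeas d)).snd y = _ from hy]
        simp only [PiLp.inner_apply, RCLike.inner_apply, conj_trivial, smul_eq_mul]

theorem grad_comp_smul {n d : ℕ} {θ : Sp d → Vec n} (hθ : ContDiff ℝ ∞ θ) (c : ℝ) (y : Sp d) :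
    grad (fun z => θ (c • z)) y = c • grad θ (c • y) := by
  ext I
  rw [grad_apply, PiLp.smul_apply, grad_apply]
  have h1 : HasFDerivAt (fun z : Sp d => c • z) (c • ContinuousLinearMap.id ℝ (Sp d)) y :=
    (hasFDerivAt_id y).const_smul c
  have h2 := ((hθ.differentiable (by simp) (c • y)).hasFDerivAt.comp y h1).fderiv
  rw [show (fun z => θ (c • z)) = θ ∘ fun z => c • z from rfl, h2]
  simp

/-- The substitution `x = ε y` reduces to period one; the chain rule and the Jacobian contribute
only non-zero factors. -/
theorem IsDivFree.integral_grad_smul_eq_zero {n d : ℕ} {B : L2 (Mat n d) (cellMeas d)}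
    (hB : IsDivFree B) {θ : Sp d → Vec n} (hθ : ContDiff ℝ ∞ θ) (hc : HasCompactSupport θ)
    {ε : ℝ} (hε : 0 < ε) : ∫ x, inner ℝ (grad θ x) (B (frac (ε⁻¹ • x))) = 0 := by
  have h1 := hB.integral_grad_eq_zero (θ := fun y => θ (ε • y))
    (hθ.comp (contDiff_const_smul ε)) (hc.comp_smul hε.ne')
  simp only [grad_comp_smul hθ, real_inner_smul_left] at h1
  rw [integral_const_mul, mul_eq_zero, or_iff_right hε.ne'] at h1
  have h2 := Measure.integral_comp_smul (volume : Measure (Sp d))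
    (fun x => inner ℝ (grad θ x) (B (frac (ε⁻¹ • x)))) ε
  simp only [inv_smul_smul₀ hε.ne'] at h2
  rw [h1, eq_comm, smul_eq_zero] at h2
  refine h2.resolve_left ?_
  positivity

theorem column_apply {n d : ℕ} (j : Fin d) (ζ : Mat n d) (i : Fin n) :
    column n j ζ i = ζ (i, j) := rfl

theorem inner_grad_smul {n d : ℕ} {φ : Sp d → ℝ} (hφ : ContDiff ℝ ∞ φ) {θ : Sp d → Vec n}
    (hθ : ContDiff ℝ ∞ θ) (x : Sp d) (ζ : Mat n d) :
    inner ℝ (grad (fun z => φ z • θ z) x) ζ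
      = inner ℝ (grad θ x) (φ x • ζ) + ∑ j, inner ℝ (θ x) (pderiv φ j x • column n j ζ) := by
  have hd := ((hφ.differentiable (by simp) x).hasFDerivAt.smul
    (hθ.differentiable (by simp) x).hasFDerivAt).fderiv
  have hg : ∀ I, grad (fun z => φ z • θ z) x I
      = φ x * grad θ x I + pderiv φ I.2 x * θ x I.1 := by
    intro I
    rw [grad_apply, show (fun z => φ z • θ z) = φ • θ from rfl, hd]
    simp [grad_apply, pderiv]
  simp only [PiLp.inner_apply, RCLike.inner_apply, conj_trivial, PiLp.smul_apply, smul_eq_mul, hg,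
    column_apply]
  rw [Finset.sum_comm, Fintype.sum_prod_type, Fintype.sum_prod_type, ← Finset.sum_add_distrib]
  refine Finset.sum_congr rfl fun i _ => ?_
  rw [← Finset.sum_add_distrib]
  exact Finset.sum_congr rfl fun j _ => by ring

theorem grad_eq_zero_of_notMem_tsupport {n d : ℕ} {θ : Sp d → Vec n} {x : Sp d}
    (hx : x ∉ tsupport θ) : grad θ x = 0 := by
  ext I
  rw [grad_apply, image_eq_zero_of_notMem_tsupport (fun h => hx (tsupport_fderiv_subset ℝ h))]
  rfl

/-- Test the divergence-free field `B(x/ε)` with `φ θ` and use the product rule. The support of `θ`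
lies in `Ω`, so all integrals extend to `ℝ^d` whatever `φ` does near `∂Ω`. -/
theorem IsDivFree.integral_by_parts_of_contDiff {n d : ℕ} {B : L2 (Mat n d) (cellMeas d)}
    (hB : IsDivFree B) {Ω : Set (Sp d)} {u : L2 (Vec n) ((volume : Measure (Sp d)).restrict Ω)}
    {g : L2 (Mat n d) ((volume : Measure (Sp d)).restrict Ω)}
    {θ : Sp d → Vec n} (hθ : ContDiff ℝ ∞ θ) (hc : HasCompactSupport θ) (hsub : tsupport θ ⊆ Ω)
    (hu : u =ᵐ[volume.restrict Ω] θ) (hg : g =ᵐ[volume.restrict Ω] grad θ)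
    {φ : Sp d → ℝ} (hφ : ContDiff ℝ ∞ φ) (hφc : HasCompactSupport φ)
    {ε : ℝ} (hε : 0 < ε) (hε1 : ε ≤ 1) :
    (∫ x in Ω, inner ℝ (g x) (φ x • B (frac (ε⁻¹ • x))))
      + ∑ j, ∫ x in Ω, inner ℝ (u x)
          (pderiv φ j x • ((column n j).compLp B) (frac (ε⁻¹ • x))) = 0 := by
  have hcol : ∀ᵐ x ∂(volume.restrict Ω), ∀ j, ((column n j).compLp B) (frac (ε⁻¹ • x))
      = column n j (B (frac (ε⁻¹ • x))) := ae_all_iff.2 fun j =>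
    (quasiMeasurePreserving_frac_smul_restrict (inv_ne_zero hε.ne') Ω).ae
      ((column n j).coeFn_compLp B)
  have hi₁ : Integrable (fun x => inner ℝ (g x) (φ x • B (frac (ε⁻¹ • x))))
      (volume.restrict Ω) :=
    (Lp.memLp g).integrable_inner_of_two
      (memLp_oscillating hφ.continuous hφc hε hε1 (Lp.memLp B) Ω)
  have hi₂ : ∀ j ∈ Finset.univ, Integrable (fun x => inner ℝ (u x)
      (pderiv φ j x • ((column n j).compLp B) (frac (ε⁻¹ • x)))) (volume.restrict Ω) := fun j _ =>
    (Lp.memLp u).integrable_inner_of_two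
      (memLp_oscillating (continuous_pderiv hφ j) (hasCompactSupport_pderiv hφc j) hε hε1
        (Lp.memLp ((column n j).compLp B)) Ω)
  have h0 := hB.integral_grad_smul_eq_zero (hφ.smul hθ) (hc.smul_left (f := φ)) hε
  have hsupp : Function.support (fun x => inner ℝ (grad (fun z => φ z • θ z) x)
      (B (frac (ε⁻¹ • x)))) ⊆ Ω := by
    intro x hx
    refine hsub ?_
    by_contra hx'
    refine hx ?_
    simp only [grad_eq_zero_of_notMem_tsupport
      fun h => hx' (tsupport_smul_subset_right φ θ h), inner_zero_left]
  rw [← integral_finsetSum _ hi₂, ← integral_add hi₁ (integrable_finsetSum _ hi₂), ← h0]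
  refine Eq.trans ?_ (setIntegral_eq_integral_of_tsupport_subset hsupp)
  refine integral_congr_ae ?_
  filter_upwards [hu, hg, hcol] with x h1 h2 h3
  rw [h1, h2, show φ • θ = fun z => φ z • θ z from rfl, inner_grad_smul hφ hθ]
  simp only [h3]

/-- For fixed `ε` both sides are continuous in the pair `(u, ∇u)`, so the smooth case passes to the
closure. No regularity of `∂Ω` is used. -/
theorem IsDivFree.integral_by_parts {n d : ℕ} {B : L2 (Mat n d) (cellMeas d)} (hB : IsDivFree B)
    {Ω : Set (Sp d)} {u : Pairs n ((volume : Measure (Sp d)).restrict Ω)} (hu : u ∈ H10 n Ω)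
    {φ : Sp d → ℝ} (hφ : ContDiff ℝ ∞ φ) (hφc : HasCompactSupport φ)
    {ε : ℝ} (hε : 0 < ε) (hε1 : ε ≤ 1) :
    ∫ x in Ω, inner ℝ (u.snd x) (φ x • B (frac (ε⁻¹ • x)))
      = - ∑ j, ∫ x in Ω, inner ℝ (u.fst x)
          (pderiv φ j x • ((column n j).compLp B) (frac (ε⁻¹ • x))) := by
  have hβ : ∀ w : L2 (Mat n d) ((volume : Measure (Sp d)).restrict Ω),
      inner ℝ w (oscillating hφ.continuous hφc hε hε1 Ω B)
        = ∫ x in Ω, inner ℝ (w x) (φ x • B (frac (ε⁻¹ • x))) := fun w => by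
    rw [L2.inner_def]
    refine integral_congr_ae ?_
    filter_upwards [oscillating_coeFn hφ.continuous hφc hε hε1 Ω B] with x hx
    rw [hx]
  have hγ : ∀ (w : L2 (Vec n) ((volume : Measure (Sp d)).restrict Ω)) (j : Fin d),
      inner ℝ w (oscillating (continuous_pderiv hφ j) (hasCompactSupport_pderiv hφc j) hε hε1 Ω
        ((column n j).compLp B)) = ∫ x in Ω, inner ℝ (w x)
          (pderiv φ j x • ((column n j).compLp B) (frac (ε⁻¹ • x))) := fun w j => by
    rw [L2.inner_def]
    refine integral_congr_ae ?_
    filter_upwards [oscillating_coeFn (continuous_pderiv hφ j)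
      (hasCompactSupport_pderiv hφc j) hε hε1 Ω ((column n j).compLp B)] with x hx
    rw [hx]
  refine eq_neg_of_add_eq_zero_left ?_
  have hcl : IsClosed {w : Pairs n ((volume : Measure (Sp d)).restrict Ω) |
      (∫ x in Ω, inner ℝ (w.snd x) (φ x • B (frac (ε⁻¹ • x))))
        + ∑ j, ∫ x in Ω, inner ℝ (w.fst x)
          (pderiv φ j x • ((column n j).compLp B) (frac (ε⁻¹ • x))) = 0} := by
    have hc := WithLp.prod_continuous_ofLp 2 (L2 (Vec n) ((volume : Measure (Sp d)).restrict Ω))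
      (L2 (Mat n d) ((volume : Measure (Sp d)).restrict Ω))
    simp only [← hβ, ← hγ]
    exact isClosed_eq ((hc.snd.inner continuous_const).add
      (continuous_finsetSum _ fun j _ => hc.fst.inner continuous_const)) continuous_const
  refine (closure_minimal ?_ hcl) hu
  rintro w ⟨θ, hθ, hc, hsub, hw1, hw2⟩
  exact hB.integral_by_parts_of_contDiff hθ hc hsub hw1 hw2 hφ hφc hε hε1

/-! ### From products `φ(x) b(y)` to general test fields -/

section Slow

variable {d : ℕ} {H H₂ : Type*} [NormedAddCommGroup H] [InnerProductSpace ℝ H]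
  [NormedAddCommGroup H₂] [InnerProductSpace ℝ H₂]

/-- `∑_j L_j ∂Ψ/∂x_j`. -/
noncomputable def slowDiv (L : Fin d → H →L[ℝ] H₂) (Ψ : Sp d → H) (x : Sp d) : H₂ :=
  ∑ j, L j (fderiv ℝ Ψ x (basisVec d j))

/-- For `w ⊥ W` the function `⟨w, Ψ⟩` vanishes near `x`, hence so does its derivative; and `W`
equals its double orthogonal complement because it is complete. -/
theorem fderiv_mem_of_mem (W : Submodule ℝ H) [CompleteSpace W] {Ω : Set (Sp d)} (hΩ : IsOpen Ω)
    {Ψ : Sp d → H} (hΨ : Differentiable ℝ Ψ) (hW : ∀ x ∈ Ω, Ψ x ∈ W) {x : Sp d} (hx : x ∈ Ω)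
    (v : Sp d) : fderiv ℝ Ψ x v ∈ W := by
  rw [← W.orthogonal_orthogonal, Submodule.mem_orthogonal]
  intro w hw
  have h1 : (fun z => inner ℝ w (Ψ z)) =ᶠ[𝓝 x] fun _ => 0 := by
    filter_upwards [hΩ.mem_nhds hx] with z hz
    rw [real_inner_comm]
    exact (Submodule.mem_orthogonal _ _).1 hw _ (hW z hz)
  have h2 := ((innerSL ℝ w).hasFDerivAt.comp x (hΨ x).hasFDerivAt).fderiv
  have h3 : fderiv ℝ (fun z => inner ℝ w (Ψ z)) x = 0 := by
    rw [h1.fderiv_eq]; simp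
  have h4 := congrArg (fun T : Sp d →L[ℝ] ℝ => T v) (h2.symm.trans h3)
  simpa using h4

theorem continuous_fderiv_basisVec {Ψ : Sp d → H} (hΨ : ContDiff ℝ ∞ Ψ) (j : Fin d) :
    Continuous fun x => fderiv ℝ Ψ x (basisVec d j) :=
  (hΨ.continuous_fderiv (by simp)).clm_apply continuous_const

theorem exists_monotone_finiteDimensional [TopologicalSpace.SeparableSpace H]
    (W : Submodule ℝ H) [CompleteSpace W] :
    ∃ S : ℕ → Submodule ℝ H, Monotone S ∧ (∀ N, FiniteDimensional ℝ (S N)) ∧ (∀ N, S N ≤ W) ∧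
      W ≤ (⨆ N, S N).topologicalClosure := by
  have : SecondCountableTopology H := UniformSpace.secondCountable_of_separable H
  let w : ℕ → W := TopologicalSpace.denseSeq W
  refine ⟨fun N => Submodule.span ℝ ((fun i => (w i : H)) '' Set.Iio N), ?_, ?_, ?_, ?_⟩
  · exact fun N M hNM => Submodule.span_mono (Set.image_mono (Set.Iio_subset_Iio hNM))
  · exact fun N => FiniteDimensional.span_of_finite ℝ ((Set.finite_Iio N).image _)
  · intro N
    rw [Submodule.span_le]
    rintro _ ⟨i, -, rfl⟩
    exact (w i).2
  · intro x hx
    rw [← SetLike.mem_coe, Submodule.topologicalClosure_coe]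
    have h1 : (⟨x, hx⟩ : W) ∈ closure (Set.range w) :=
      TopologicalSpace.denseRange_denseSeq W ⟨x, hx⟩
    have h2 := image_closure_subset_closure_image (continuous_subtype_val (p := (· ∈ W)))
      (Set.mem_image_of_mem _ h1)
    refine closure_mono ?_ h2
    rintro _ ⟨_, ⟨i, rfl⟩, rfl⟩
    -- Stage `N` spans the vectors with index below `N`, so the `i`-th one enters at stage `i + 1`.
    exact (le_iSup (fun N => Submodule.span ℝ ((fun i => (w i : H)) '' Set.Iio N)) (i + 1))
      (Submodule.subset_span ⟨i, Set.mem_Iio.2 i.lt_succ_self, rfl⟩)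

theorem starProjection_eq_sum_inner (S : Submodule ℝ H) [FiniteDimensional ℝ S] (z : H) :
    S.starProjection z = ∑ k, inner ℝ (stdOrthonormalBasis ℝ S k : H) z •
      (stdOrthonormalBasis ℝ S k : H) := by
  rw [(stdOrthonormalBasis ℝ S).starProjection_eq_sum_rankOne]
  simp

/-- The integration by parts identity for products `φ(x) b`, `b ∈ W`. -/
def HasProductIdentity (Ω : Set (Sp d)) (W : Submodule ℝ H) (L : Fin d → H →L[ℝ] H₂)
    (ξ : Sp d → H) (u : Sp d → H₂) : Prop :=
  ∀ φ : Sp d → ℝ, ContDiff ℝ ∞ φ → HasCompactSupport φ → ∀ b ∈ W,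
    ∫ x in Ω, φ x * inner ℝ (ξ x) b = - ∑ j, ∫ x in Ω, pderiv φ j x * inner ℝ (u x) (L j b)

variable {Ω : Set (Sp d)} {W : Submodule ℝ H} {L : Fin d → H →L[ℝ] H₂}
  {ξ : Sp d → H} {u : Sp d → H₂}

/-- In an orthonormal basis `e_k` of `S ≤ W` the projected field is the finite sum of products
`⟨e_k, Ψ(x)⟩ e_k`, each covered by the product identity. `Ψ` itself need not take values in `W`. -/
theorem HasProductIdentity.projection (h : HasProductIdentity Ω W L ξ u)
    (hξ : MemLp ξ 2 (volume.restrict Ω)) (hu : MemLp u 2 (volume.restrict Ω))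
    {S : Submodule ℝ H} [FiniteDimensional ℝ S] (hS : S ≤ W) {Ψ : Sp d → H}
    (hΨ : ContDiff ℝ ∞ Ψ) (hc : HasCompactSupport Ψ) :
    ∫ x in Ω, inner ℝ (ξ x) (S.starProjection (Ψ x))
      = - ∫ x in Ω, inner ℝ (u x)
          (∑ j, L j (S.starProjection (fderiv ℝ Ψ x (basisVec d j)))) := by
  let e := stdOrthonormalBasis ℝ S
  let φ : Fin (Module.finrank ℝ S) → Sp d → ℝ := fun k x => inner ℝ (e k : H) (Ψ x)
  have hφ : ∀ k, ContDiff ℝ ∞ (φ k) := fun k => (innerSL ℝ (e k : H)).contDiff.comp hΨ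
  have hφc : ∀ k, HasCompactSupport (φ k) := fun k =>
    hc.comp_left (g := fun z : H => inner ℝ (e k : H) z) (by simp)
  have hpd : ∀ k j x, pderiv (φ k) j x = inner ℝ (e k : H) (fderiv ℝ Ψ x (basisVec d j)) := by
    intro k j x
    have h2 := ((innerSL ℝ (e k : H)).hasFDerivAt.comp x
      (hΨ.differentiable (by simp) x).hasFDerivAt).fderiv
    exact congrArg (fun T : Sp d →L[ℝ] ℝ => T (basisVec d j)) h2
  have hi₁ : ∀ k ∈ Finset.univ, Integrable (fun x => φ k x * inner ℝ (ξ x) (e k : H))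
      (volume.restrict Ω) := fun k _ => by
    have hm : MemLp (φ k) 2 (volume.restrict Ω) :=
      (hφ k).continuous.memLp_of_hasCompactSupport (hφc k)
    exact hm.integrable_mul (hξ.inner_const (e k : H))
  have hi₂ : ∀ k j, Integrable (fun x => pderiv (φ k) j x * inner ℝ (u x) (L j (e k : H)))
      (volume.restrict Ω) := fun k j => by
    have hm : MemLp (pderiv (φ k) j) 2 (volume.restrict Ω) :=
      (continuous_pderiv (hφ k) j).memLp_of_hasCompactSupport (hasCompactSupport_pderiv (hφc k) j)
    exact hm.integrable_mul (hu.inner_const (L j (e k : H)))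
  calc ∫ x in Ω, inner ℝ (ξ x) (S.starProjection (Ψ x))
      = ∫ x in Ω, ∑ k, φ k x * inner ℝ (ξ x) (e k : H) := by
        simp only [starProjection_eq_sum_inner, inner_sum, inner_smul_right]
        rfl
    _ = ∑ k, ∫ x in Ω, φ k x * inner ℝ (ξ x) (e k : H) := integral_finsetSum _ hi₁
    _ = ∑ k, - ∑ j, ∫ x in Ω, pderiv (φ k) j x * inner ℝ (u x) (L j (e k : H)) :=
        Finset.sum_congr rfl fun k _ => h (φ k) (hφ k) (hφc k) _ (hS (e k).2)
    _ = - ∫ x in Ω, ∑ k, ∑ j, pderiv (φ k) j x * inner ℝ (u x) (L j (e k : H)) := by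
        rw [Finset.sum_neg_distrib, integral_finsetSum _ fun k _ =>
          integrable_finsetSum _ fun j _ => hi₂ k j]
        congr 1
        exact Finset.sum_congr rfl fun k _ => (integral_finsetSum _ fun j _ => hi₂ k j).symm
    _ = _ := by
        congr 1
        refine integral_congr_ae (ae_of_all _ fun x => ?_)
        dsimp only
        rw [Finset.sum_comm, inner_sum]
        refine Finset.sum_congr rfl fun j _ => ?_
        rw [starProjection_eq_sum_inner, map_sum, inner_sum]
        refine Finset.sum_congr rfl fun k _ => ?_
        rw [map_smul, inner_smul_right, hpd]

/-- On `Ω` both `Ψ` and its partial derivatives lie in `W`, so their projections onto subspaces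
exhausting `W` converge pointwise. Projections do not increase norms, which supplies the integrable
majorants. -/
theorem HasProductIdentity.of_hasCompactSupport [CompleteSpace H]
    [TopologicalSpace.SeparableSpace H] [CompleteSpace W] (hΩ : IsOpen Ω)
    (h : HasProductIdentity Ω W L ξ u)
    (hξ : MemLp ξ 2 (volume.restrict Ω)) (hu : MemLp u 2 (volume.restrict Ω))
    {Ψ : Sp d → H} (hΨ : ContDiff ℝ ∞ Ψ) (hc : HasCompactSupport Ψ) (hΨW : ∀ x ∈ Ω, Ψ x ∈ W) :
    ∫ x in Ω, inner ℝ (ξ x) (Ψ x) = - ∫ x in Ω, inner ℝ (u x) (slowDiv L Ψ x) := by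
  obtain ⟨S, hmono, hfin, hSW, hWS⟩ := exists_monotone_finiteDimensional W
  have hproj : ∀ z ∈ W, Tendsto (fun N => (S N).starProjection z) atTop (𝓝 z) := by
    intro z hz
    have := Submodule.starProjection_tendsto_closure_iSup S hmono z
    rwa [Submodule.starProjection_eq_self_iff.2 (hWS hz)] at this
  have hdc : ∀ j, Continuous fun x => fderiv ℝ Ψ x (basisVec d j) :=
    continuous_fderiv_basisVec hΨ
  have hds : ∀ j, HasCompactSupport fun x => fderiv ℝ Ψ x (basisVec d j) := fun j =>
    hc.fderiv_apply ℝ _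
  have hmem : ∀ᵐ x ∂(volume.restrict Ω), x ∈ Ω := ae_restrict_mem hΩ.measurableSet
  have hb₁ : Integrable (fun x => ‖ξ x‖ * ‖Ψ x‖) (volume.restrict Ω) :=
    have hm : MemLp Ψ 2 (volume.restrict Ω) := hΨ.continuous.memLp_of_hasCompactSupport hc
    hξ.norm.integrable_mul hm.norm
  have hb₂ : Integrable (fun x => ∑ j, ‖u x‖ * (‖L j‖ * ‖fderiv ℝ Ψ x (basisVec d j)‖))
      (volume.restrict Ω) :=
    integrable_finsetSum _ fun j _ => by
      have hm : MemLp (fun x => fderiv ℝ Ψ x (basisVec d j)) 2 (volume.restrict Ω) :=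
        (hdc j).memLp_of_hasCompactSupport (hds j)
      exact hu.norm.integrable_mul (hm.norm.const_mul _)
  have l₁ : Tendsto (fun N => ∫ x in Ω, inner ℝ (ξ x) ((S N).starProjection (Ψ x))) atTop
      (𝓝 (∫ x in Ω, inner ℝ (ξ x) (Ψ x))) := by
    refine tendsto_integral_of_dominated_convergence _ (fun N => ?_) hb₁ (fun N => ?_) ?_
    · exact hξ.aestronglyMeasurable.inner
        ((S N).starProjection.continuous.comp hΨ.continuous).aestronglyMeasurable
    · refine ae_of_all _ fun x => (norm_inner_le_norm _ _).trans ?_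
      exact mul_le_mul_of_nonneg_left ((S N).norm_starProjection_apply_le _) (norm_nonneg _)
    · filter_upwards [hmem] with x hx
      exact tendsto_const_nhds.inner (hproj _ (hΨW x hx))
  have l₂ : Tendsto (fun N => ∫ x in Ω, inner ℝ (u x)
      (∑ j, L j ((S N).starProjection (fderiv ℝ Ψ x (basisVec d j))))) atTop
      (𝓝 (∫ x in Ω, inner ℝ (u x) (slowDiv L Ψ x))) := by
    refine tendsto_integral_of_dominated_convergence _ (fun N => ?_) hb₂ (fun N => ?_) ?_
    · refine hu.aestronglyMeasurable.inner (Continuous.aestronglyMeasurable ?_)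
      exact continuous_finsetSum _ fun j _ =>
        (L j).continuous.comp ((S N).starProjection.continuous.comp (hdc j))
    · refine ae_of_all _ fun x => ?_
      rw [inner_sum]
      refine (norm_sum_le _ _).trans (Finset.sum_le_sum fun j _ => ?_)
      refine (norm_inner_le_norm _ _).trans (mul_le_mul_of_nonneg_left ?_ (norm_nonneg _))
      refine ((L j).le_opNorm _).trans (mul_le_mul_of_nonneg_left ?_ (norm_nonneg _))
      exact (S N).norm_starProjection_apply_le _
    · filter_upwards [hmem] with x hx
      refine tendsto_const_nhds.inner (tendsto_finsetSum _ fun j _ => ?_)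
      exact ((L j).continuous.tendsto _).comp (hproj _
        (fderiv_mem_of_mem W hΩ (hΨ.differentiable (by simp)) hΨW hx _))
  refine tendsto_nhds_unique l₁ ?_
  refine l₂.neg.congr fun N => ?_
  exact (h.projection hξ hu (hSW N) hΨ hc).symm

theorem slowDiv_smul {χ : Sp d → ℝ} (hχ : ContDiff ℝ ∞ χ) {Ψ : Sp d → H} (hΨ : ContDiff ℝ ∞ Ψ)
    (x : Sp d) : slowDiv L (fun z => χ z • Ψ z) x
      = χ x • slowDiv L Ψ x + ∑ j, pderiv χ j x • L j (Ψ x) := by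
  have hd := ((hχ.differentiable (by simp) x).hasFDerivAt.smul
    (hΨ.differentiable (by simp) x).hasFDerivAt).fderiv
  rw [slowDiv, show (fun z => χ z • Ψ z) = χ • Ψ from rfl, hd, slowDiv, Finset.smul_sum,
    ← Finset.sum_add_distrib]
  refine Finset.sum_congr rfl fun j _ => ?_
  simp [pderiv]

/-- Dilate one bump: `χ_N(x) = f(x/(N+1))`, whose derivatives carry a factor `1/(N+1)`. -/
theorem exists_cutoff (d : ℕ) : ∃ (χ : ℕ → Sp d → ℝ) (C : ℝ), 0 ≤ C ∧
    (∀ N, ContDiff ℝ ∞ (χ N)) ∧ (∀ N, HasCompactSupport (χ N)) ∧ (∀ N x, |χ N x| ≤ 1) ∧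
    (∀ N j x, |pderiv (χ N) j x| ≤ C) ∧ (∀ x, Tendsto (fun N => χ N x) atTop (𝓝 1)) ∧
    ∀ j x, Tendsto (fun N => pderiv (χ N) j x) atTop (𝓝 0) := by
  let f : ContDiffBump (0 : Sp d) := ⟨1, 2, one_pos, one_lt_two⟩
  have hf : ContDiff ℝ ∞ f := f.contDiff
  have hfc : HasCompactSupport f := f.hasCompactSupport
  choose B hB using fun j => (hasCompactSupport_pderiv hfc j).exists_bound_of_continuous
    (continuous_pderiv hf j)
  have hB0 : ∀ j, 0 ≤ B j := fun j => (norm_nonneg _).trans (hB j 0)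
  let c : ℕ → ℝ := fun N => 1 / ((N : ℝ) + 1)
  have hc : Tendsto c atTop (𝓝 0) := tendsto_one_div_add_atTop_nhds_zero_nat
  have hc0 : ∀ N, 0 < c N := fun N => by positivity
  have hc1 : ∀ N, c N ≤ 1 := fun N => by
    rw [div_le_one (by positivity)]
    linarith [(Nat.cast_nonneg N : (0 : ℝ) ≤ N)]
  have hpd : ∀ N j x, pderiv (fun z => f (c N • z)) j x = c N * pderiv f j (c N • x) := by
    intro N j x
    have h1 : HasFDerivAt (fun z : Sp d => c N • z) (c N • ContinuousLinearMap.id ℝ (Sp d)) x :=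
      (hasFDerivAt_id x).const_smul (c N)
    have h2 := ((hf.differentiable (by simp) (c N • x)).hasFDerivAt.comp x h1).fderiv
    rw [pderiv, show (fun z => f (c N • z)) = f ∘ fun z => c N • z from rfl, h2]
    simp [pderiv]
  have hpd' : ∀ N j x, |pderiv (fun z => f (c N • z)) j x| ≤ c N * B j := fun N j x => by
    rw [hpd, abs_mul, abs_of_pos (hc0 N)]
    exact mul_le_mul_of_nonneg_left (hB j _) (hc0 N).le
  refine ⟨fun N x => f (c N • x), ∑ j, B j, Finset.sum_nonneg fun j _ => hB0 j,
    fun N => hf.comp (contDiff_const_smul _), fun N => hfc.comp_smul (hc0 N).ne', ?_, ?_, ?_, ?_⟩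
  · intro N x
    rw [abs_of_nonneg f.nonneg]
    exact f.le_one
  · intro N j x
    refine (hpd' N j x).trans ((mul_le_of_le_one_left (hB0 j) (hc1 N)).trans ?_)
    exact Finset.single_le_sum (fun j _ => hB0 j) (Finset.mem_univ j)
  · intro x
    have h1 : Tendsto (fun N => f (c N • x)) atTop (𝓝 (f ((0 : ℝ) • x))) :=
      (hf.continuous.tendsto _).comp (hc.smul_const x)
    rwa [zero_smul, f.one_of_mem_closedBall (by simp [f])] at h1
  · intro j x
    refine squeeze_zero_norm (fun N => hpd' N j x) ?_
    simpa using hc.mul_const (B j)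

/-- Apply the compactly supported case to `χ_N Ψ` and let `N → ∞`. The divergence of `χ_N Ψ` is
`χ_N` times that of `Ψ` plus terms `∂_jχ_N L_j Ψ`, which tend to zero. Only the full divergence, not
each partial derivative, has to be square integrable. -/
theorem HasProductIdentity.integral_eq [CompleteSpace H]
    [TopologicalSpace.SeparableSpace H] [CompleteSpace W] (hΩ : IsOpen Ω) (h : HasProductIdentity Ω W L ξ u)
    (hξ : MemLp ξ 2 (volume.restrict Ω)) (hu : MemLp u 2 (volume.restrict Ω))
    {Ψ : Sp d → H} (hΨ : ContDiff ℝ ∞ Ψ) (hΨW : ∀ x ∈ Ω, Ψ x ∈ W)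
    (hΨ2 : MemLp Ψ 2 (volume.restrict Ω)) (hdiv : MemLp (slowDiv L Ψ) 2 (volume.restrict Ω)) :
    ∫ x in Ω, inner ℝ (ξ x) (Ψ x) = - ∫ x in Ω, inner ℝ (u x) (slowDiv L Ψ x) := by
  obtain ⟨χ, C, hC0, hχs, hχc, hχ1, hχC, hχlim, hχlim'⟩ := exists_cutoff d
  have hb₁ : Integrable (fun x => ‖ξ x‖ * ‖Ψ x‖) (volume.restrict Ω) :=
    hξ.norm.integrable_mul hΨ2.norm
  have hb₂ : Integrable (fun x => ‖u x‖ * ‖slowDiv L Ψ x‖ + ∑ j, ‖u x‖ * (C * ‖L j‖ * ‖Ψ x‖))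
      (volume.restrict Ω) :=
    (hu.norm.integrable_mul hdiv.norm).add (integrable_finsetSum _ fun j _ =>
      hu.norm.integrable_mul (hΨ2.norm.const_mul _))
  have l₁ : Tendsto (fun N => ∫ x in Ω, inner ℝ (ξ x) (χ N x • Ψ x)) atTop
      (𝓝 (∫ x in Ω, inner ℝ (ξ x) (Ψ x))) := by
    refine tendsto_integral_of_dominated_convergence _ (fun N => ?_) hb₁ (fun N => ?_) ?_
    · exact hξ.aestronglyMeasurable.inner
        ((hχs N).continuous.aestronglyMeasurable.smul hΨ2.aestronglyMeasurable)
    · refine ae_of_all _ fun x => (norm_inner_le_norm _ _).trans ?_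
      refine mul_le_mul_of_nonneg_left ?_ (norm_nonneg _)
      rw [norm_smul]
      exact mul_le_of_le_one_left (norm_nonneg _) (hχ1 N x)
    · refine ae_of_all _ fun x => tendsto_const_nhds.inner ?_
      simpa using (hχlim x).smul_const (Ψ x)
  have l₂ : Tendsto (fun N => ∫ x in Ω, inner ℝ (u x) (slowDiv L (fun z => χ N z • Ψ z) x)) atTop
      (𝓝 (∫ x in Ω, inner ℝ (u x) (slowDiv L Ψ x))) := by
    simp only [fun N => slowDiv_smul (L := L) (hχs N) hΨ]
    refine tendsto_integral_of_dominated_convergence _ (fun N => ?_) hb₂ (fun N => ?_) ?_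
    · refine hu.aestronglyMeasurable.inner (AEStronglyMeasurable.add ?_ ?_)
      · exact (hχs N).continuous.aestronglyMeasurable.smul hdiv.aestronglyMeasurable
      · refine Continuous.aestronglyMeasurable (continuous_finsetSum _ fun j _ => ?_)
        exact (continuous_pderiv (hχs N) j).smul ((L j).continuous.comp hΨ.continuous)
    · refine ae_of_all _ fun x => ?_
      rw [inner_add_right, inner_sum]
      refine (norm_add_le _ _).trans (add_le_add ?_ ?_)
      · refine (norm_inner_le_norm _ _).trans (mul_le_mul_of_nonneg_left ?_ (norm_nonneg _))
        rw [norm_smul]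
        exact mul_le_of_le_one_left (norm_nonneg _) (hχ1 N x)
      · refine (norm_sum_le _ _).trans (Finset.sum_le_sum fun j _ => ?_)
        refine (norm_inner_le_norm _ _).trans (mul_le_mul_of_nonneg_left ?_ (norm_nonneg _))
        rw [norm_smul, mul_assoc]
        exact mul_le_mul (hχC N j x) ((L j).le_opNorm _) (norm_nonneg _) hC0
    · refine ae_of_all _ fun x => tendsto_const_nhds.inner ?_
      have e1 : Tendsto (fun N => χ N x • slowDiv L Ψ x) atTop (𝓝 (slowDiv L Ψ x)) := by
        simpa using (hχlim x).smul_const (slowDiv L Ψ x)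
      have e2 : Tendsto (fun N => ∑ j, pderiv (χ N) j x • L j (Ψ x)) atTop (𝓝 0) := by
        simpa using tendsto_finsetSum Finset.univ fun j _ =>
          (hχlim' j x).smul_const (L j (Ψ x))
      simpa using e1.add e2
  refine tendsto_nhds_unique l₁ ?_
  refine l₂.neg.congr fun N => ?_
  refine (h.of_hasCompactSupport hΩ hξ hu ((hχs N).smul hΨ) ((hχc N).smul_right) ?_).symm
  exact fun x hx => W.smul_mem _ (hΨW x hx)

end Slow

/-! ### The product identity for the two-scale limits -/

/-- `W` as a subspace of `L²(Q)`, for a bounded root `(a^{(1)})^{1/2}`. -/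
noncomputable def subspaceW {n d : ℕ} {b : Sp d → Tens n d} (hb : IsBddTensor b) :
    Submodule ℝ (L2 (Mat n d) (cellMeas d)) :=
  ⨅ w ∈ H1per n d,
    LinearMap.ker ((innerSL ℝ w.snd).comp (mulTensor hb _ (cellMeas_ac d))).toLinearMap

theorem isClosed_subspaceW {n d : ℕ} {b : Sp d → Tens n d} (hb : IsBddTensor b) :
    IsClosed (subspaceW hb : Set (L2 (Mat n d) (cellMeas d))) := by
  simp only [subspaceW, Submodule.coe_iInf]
  exact isClosed_biInter fun w _ => ContinuousLinearMap.isClosed_ker _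

theorem mem_subspaceW_iff {n d : ℕ} {b : Sp d → Tens n d} (hb : IsBddTensor b)
    {ψ : L2 (Mat n d) (cellMeas d)} :
    ψ ∈ subspaceW hb ↔ IsDivFree (mulTensor hb _ (cellMeas_ac d) ψ) := by
  simp only [subspaceW, Submodule.mem_iInf, IsDivFree]
  refine forall₂_congr fun w _ => ?_
  change inner ℝ w.snd (mulTensor hb _ (cellMeas_ac d) ψ) = 0 ↔ _
  rw [real_inner_comm, L2.inner_def]

theorem mem_spaceW_iff {n d : ℕ} {a : Sp d → Tens n d}
    (hb : IsBddTensor fun y => tensSqrt (a y)) {ψ : L2 (Mat n d) (cellMeas d)} :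
    ψ ∈ spaceW a ↔ ψ ∈ subspaceW hb := by
  rw [mem_subspaceW_iff]
  refine forall₂_congr fun w _ => ?_
  rw [integral_congr_ae]
  filter_upwards [mulTensor_coeFn hb _ (cellMeas_ac d) ψ] with y hy
  rw [hy]

/-- `ψ ↦ (b ψ) e_j`. -/
noncomputable def mulColumn {n d : ℕ} {b : Sp d → Tens n d} (hb : IsBddTensor b) (j : Fin d) :
    L2 (Mat n d) (cellMeas d) →L[ℝ] L2 (Vec n) (cellMeas d) :=
  ((column n j).compLpL 2 (cellMeas d)).comp (mulTensor hb _ (cellMeas_ac d))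

/-- Multiplication by `b(y)` is a continuous linear operator on `L²(Q)`, so it commutes with
derivatives in `x`; the divergence of the statement takes the abstract form. -/
theorem divX_mulL2 {n d : ℕ} {b : Sp d → Tens n d} (hb : IsBddTensor b)
    {Ψ : Sp d → L2 (Mat n d) (cellMeas d)} (hΨ : Differentiable ℝ Ψ) :
    (divX fun x => mulL2 b (Ψ x)) = slowDiv (mulColumn hb) Ψ := by
  funext x
  simp only [mulL2_eq hb]
  have h := ((mulTensor hb _ (cellMeas_ac d)).hasFDerivAt.comp x (hΨ x).hasFDerivAt).fderiv
  rw [divX, slowDiv, show (fun x => mulTensor hb _ (cellMeas_ac d) (Ψ x))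
    = mulTensor hb _ (cellMeas_ac d) ∘ Ψ from rfl, h]
  rfl

theorem IsBddTensor.act_comp_frac {n d : ℕ} {b : Sp d → Tens n d} (hb : IsBddTensor b)
    (hper : IsPer b) (ψ : L2 (Mat n d) (cellMeas d)) (Ω : Set (Sp d)) {ε : ℝ} (hε : 0 < ε) :
    ∀ᵐ x ∂(volume.restrict Ω), act (b (ε⁻¹ • x)) (ψ (frac (ε⁻¹ • x)))
      = mulTensor hb _ (cellMeas_ac d) ψ (frac (ε⁻¹ • x)) := by
  filter_upwards [(quasiMeasurePreserving_frac_smul_restrict (inv_ne_zero hε.ne') Ω).ae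
    (mulTensor_coeFn hb _ (cellMeas_ac d) ψ)] with x hx
  rw [hx, hper.comp_frac]

/-- The heart of the argument: for fixed `ε` the identity is integration by parts against a
divergence-free oscillating field, and the energy bounds allow the passage to the two-scale limit on
both sides. -/
theorem hasProductIdentity {n d : ℕ} {Ω : Set (Sp d)} (hΩ : IsOpen Ω) {ν lam : ℝ} (hν : 0 < ν)
    (hlam : 0 < lam) {a₁ a₀ : Sp d → Tens n d} {ρ : Sp d → ℝ} (hcoeff : IsAdmissible ν a₁ a₀ ρ)
    {ε : ℕ → ℝ} (hε : ∀ k, 0 < ε k) (hε0 : Tendsto ε atTop (𝓝 0))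
    {f : ℕ → L2 (Vec n) ((volume : Measure (Sp d)).restrict Ω)} {C : ℝ} (hf : ∀ k, ‖f k‖ ≤ C)
    {u : ℕ → Pairs n ((volume : Measure (Sp d)).restrict Ω)}
    (hu : ∀ k, IsWeakSolution Ω a₁ a₀ ρ lam (ε k) (f k) (u k))
    {u₀ : Sp d → L2 (Vec n) (cellMeas d)} {ξ₀ : Sp d → L2 (Mat n d) (cellMeas d)}
    (hu₀ : MemLp u₀ 2 (volume.restrict Ω)) (hξ₀ : MemLp ξ₀ 2 (volume.restrict Ω))
    (hlim_u : TwoScaleTendsto Ω ε (fun k => (u k).fst) u₀)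
    (hlim_ξ : TwoScaleTendsto Ω ε
      (fun k x => act (tensSqrt (a₁ ((ε k)⁻¹ • x))) ((u k).snd x)) ξ₀) :
    HasProductIdentity Ω (subspaceW hcoeff.isBddTensor_tensSqrt)
      (mulColumn hcoeff.isBddTensor_tensSqrt) ξ₀ u₀ := by
  have hb := hcoeff.isBddTensor_tensSqrt
  have hper : IsPer fun y => tensSqrt (a₁ y) := fun j y => by
    have : a₁ (y + basisVec d j) = a₁ y := by
      ext I J
      exact (hcoeff.bdd₁ I J).1 j y
    simp only [this]
  let v : ℕ → L2 (Mat n d) ((volume : Measure (Sp d)).restrict Ω) := fun k =>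
    mulTensor (hb.comp_smul (inv_ne_zero (hε k).ne')) _
      Measure.absolutelyContinuous_restrict (u k).snd
  have hv : ∀ k, v k =ᵐ[volume.restrict Ω]
      fun x => act (tensSqrt (a₁ ((ε k)⁻¹ • x))) ((u k).snd x) := fun k =>
    mulTensor_coeFn (hb.comp_smul (inv_ne_zero (hε k).ne')) _ _ _
  obtain ⟨K, hK⟩ := exists_bound (Ω := Ω) hν hlam hcoeff C
  have hsmall : ∀ᶠ k in atTop, ε k ≤ 1 ∧ ε k ^ 2 ≤ 1 / 2 := by
    have h2 : Tendsto (fun k => ε k ^ 2) atTop (𝓝 0) := by simpa using hε0.pow 2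
    exact (hε0.eventually_le_const one_pos).and (h2.eventually_le_const (by norm_num))
  have hbound : ∀ᶠ k in atTop, ‖(u k).fst‖ ≤ K ∧ ‖v k‖ ≤ K :=
    hsmall.mono fun k hk => hK (ε k) (hε k) hk.2 (f k) (hf k) (u k) (hu k)
  have hlim_v : TwoScaleTendsto Ω ε (fun k => v k) ξ₀ := fun φ hφ => by
    refine (hlim_ξ φ hφ).congr fun k => integral_congr_ae ?_
    filter_upwards [hv k] with x hx
    rw [hx]
  intro φ hφ hφc b hbW
  have hdiv : IsDivFree (mulTensor hb _ (cellMeas_ac d) b) := (mem_subspaceW_iff hb).1 hbW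
  have l₁ := hlim_v.tendsto_oscillating hΩ hε hε0 (hbound.mono fun k hk => hk.2) hξ₀
    hφ.continuous hφc b
  have l₂ := (tendsto_finsetSum Finset.univ fun j _ =>
    hlim_u.tendsto_oscillating hΩ hε hε0 (hbound.mono fun k hk => hk.1) hu₀
      (continuous_pderiv hφ j) (hasCompactSupport_pderiv hφc j) (mulColumn hb j b)).neg
  refine tendsto_nhds_unique l₁ (l₂.congr' ?_)
  filter_upwards [hsmall] with k hk
  refine Eq.trans (hdiv.integral_by_parts (hu k).1 hφ hφc (hε k) hk.1).symm
    (integral_congr_ae ?_)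
  filter_upwards [hv k, hb.act_comp_frac hper b Ω (hε k)] with x hx hx'
  -- Symmetry moves the root from `b` to `∇u^ε`, so that the quantity with limit `ξ₀` appears.
  rw [hx, ← hx', inner_smul_right, inner_smul_right, inner_act_comm (tensSqrt_symm _)]

end TwoScale

/-! ### The integration by parts formula for the two-scale limits -/

theorem mainTheorem4 {n d : ℕ} (hn : 1 ≤ n) (hd : 2 ≤ d)
    (Ω : Set (TwoScale.Sp d)) (hΩ : IsOpen Ω)
    (ν lam : ℝ) (hν : 0 < ν) (hlam : 0 < lam)
    (a₁ a₀ : TwoScale.Sp d → TwoScale.Tens n d) (ρ : TwoScale.Sp d → ℝ)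
    (hcoeff : TwoScale.IsAdmissible ν a₁ a₀ ρ)
    (hkey : TwoScale.KeyAssumption a₁)
    (ε : ℕ → ℝ) (hε : ∀ k, 0 < ε k) (hε0 : Tendsto ε atTop (𝓝 0))
    (f : ℕ → TwoScale.L2 (TwoScale.Vec n) (volume.restrict Ω))
    (hf : ∃ C : ℝ, ∀ k, ‖f k‖ ≤ C)
    (u : ℕ → TwoScale.Pairs n (volume.restrict Ω))
    (hu : ∀ k, TwoScale.IsWeakSolution Ω a₁ a₀ ρ lam (ε k) (f k) (u k))
    (u₀ : TwoScale.Sp d → TwoScale.Pairs n (TwoScale.cellMeas d))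
    (ξ₀ : TwoScale.Sp d → TwoScale.L2 (TwoScale.Mat n d) (TwoScale.cellMeas d))
    (hu₀ : MemLp u₀ 2 (volume.restrict Ω))
    (hu₀V : ∀ᵐ x ∂(volume.restrict Ω), u₀ x ∈ TwoScale.spaceV a₁)
    (hξ₀ : MemLp ξ₀ 2 (volume.restrict Ω))
    (hξ₀W : ∀ᵐ x ∂(volume.restrict Ω), ξ₀ x ∈ TwoScale.spaceW a₁)
    (hlim₁ : TwoScale.TwoScaleTendsto Ω ε (fun k => (u k).fst) (fun x => (u₀ x).fst))
    (hlim₂ : TwoScale.TwoScaleTendsto Ω ε (fun k x => ε k • (u k).snd x) (fun x => (u₀ x).snd))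
    (hlim₃ : TwoScale.TwoScaleTendsto Ω ε
      (fun k x => TwoScale.act (TwoScale.tensSqrt (a₁ ((ε k)⁻¹ • x))) ((u k).snd x)) ξ₀) :
    ∀ Ψ : TwoScale.Sp d → TwoScale.L2 (TwoScale.Mat n d) (TwoScale.cellMeas d),
      TwoScale.IsTestField Ω a₁ Ψ →
      ∫ x in Ω, ∫ y in TwoScale.cell d, inner ℝ (ξ₀ x y) (Ψ x y)
        = - ∫ x in Ω, ∫ y in TwoScale.cell d, inner ℝ ((u₀ x).fst y)
            (TwoScale.divX
              (fun x' => TwoScale.mulL2 (fun y' => TwoScale.tensSqrt (a₁ y')) (Ψ x')) x y) := by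
  intro Ψ hΨ
  obtain ⟨C, hC⟩ := hf
  have hb := hcoeff.isBddTensor_tensSqrt
  have hu₀' : MemLp (fun x => (u₀ x).fst) 2 (volume.restrict Ω) :=
    (WithLp.fstL 2 ℝ (TwoScale.L2 (TwoScale.Vec n) (TwoScale.cellMeas d))
      (TwoScale.L2 (TwoScale.Mat n d) (TwoScale.cellMeas d))).comp_memLp' hu₀
  have : Fact ((2 : ENNReal) ≠ ⊤) := ⟨by simp⟩
  have : CompleteSpace (TwoScale.subspaceW hb) :=
    (TwoScale.isClosed_subspaceW hb).completeSpace_coe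
  have hdiv := TwoScale.divX_mulL2 hb (hΨ.smooth.differentiable (by simp))
  have key := (TwoScale.hasProductIdentity hΩ hν hlam hcoeff hε hε0 hC hu hu₀' hξ₀ hlim₁
    hlim₃).integral_eq hΩ hξ₀ hu₀' hΨ.smooth
    (fun x hx => (TwoScale.mem_spaceW_iff hb).1 (hΨ.mem x hx)) hΨ.memLp (hdiv ▸ hΨ.memLp_div)
  rw [hdiv]
  simpa only [L2.inner_def] using key
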